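/- **Conventions.** The $1$-sphere of length $n\ge 1$ is the cyclic graph with vertices $0,\dots,n-1$ and oriented edges $e_i$ from $i$ to $i+1 \pmod n$, together with their inverses; the $1$-sphere of length $0$ is a single vertex. Let $\iota$ be the reflection $i\mapsto -i$, $e_i\mapsto e_{-i-1}^{-1}$. A *$2$-complex* $X$ consists of a graph $X^{(1)}$ (vertices, edges, start vertices, and a fixed-point-free involution $e\mapsto e^{-1}$ of the edges) and a set of faces with a fixed-point-free involution $\sigma\mapsto\sigma^{-1}$, each face having a $1$-sphere $X^\sigma$ and a dimension preserving graph map $\alpha_\sigma:X^\sigma\to X^{(1)}$, with $X^{\sigma^{-1}}=X^\sigma$ and $\alpha_{\sigma^{-1}}=\alpha_\sigma\iota$. A dimension preserving map $f:Y\to X$ sends vertices, edges and faces to vertices, edges and faces, commutes with start vertices and inversion, and comes with orientation preserving isomorphisms $\varepsilon(f,\sigma):Y^\sigma\to X^{f(\sigma)}$ such that $f\alpha_\sigma=\alpha_{f(\sigma)}\varepsilon(f,\sigma)$ and $\varepsilon(f,\sigma^{-1})=\iota\,\varepsilon(f,\sigma)\,\iota$; two maps are equal if they agree on all cells and have the same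 $\varepsilon$'s, and $\varepsilon(gf,\sigma)=\varepsilon(g,f(\sigma))\varepsilon(f,\sigma)$. It is an *isomorphism* if it is bijective on vertices, edges and faces. It is a *covering* if for every vertex $y$ of $Y$ it induces bijections from the edges starting at $y$ to those starting at $f(y)$ and, via the $\varepsilon(f,\sigma)$, from $\bigsqcup_{f(\sigma)=\tau}\alpha_\sigma^{-1}(y)$ to $\alpha_\tau^{-1}(f(y))$ for every face $\tau$ of $X$. The group $\pi_1(X,v)$ consists of the closed edge paths at $v$ modulo insertion and deletion of spurs $ee^{-1}$ and of complete boundary paths of faces. All complexes are assumed connected. Pointed coverings $f_i:(Y_i)_{y_i}\to X_v$ ($i=1,2$) are *equivalent* if there is an isomorphism $g:Y_1\to Y_2$ with $g(y_1)=y_2$ and $f_2g=f_1$. Let $\mathcal L(X_v)$ be the set of equivalence classes, ordered by $[f_1]\le[f_2]$ if there is a covering $g:Y_2\to Y_1$ with $g(y_2)=y_1$ and $f_1g=f_2$. For $H\le\pi_1(X,v)$ let $X{\uparrow}H$ be the complex whose vertices are the classes $u_\gamma$ of paths $\gamma$ starting at $v$, where $\gamma_1\sim\gamma_2$ if $\gamma_1\gamma_2^{-1}$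 is a closed path representing an element of $H$; with an edge from $u_\gamma$ to $u_{\gamma e}$ for every vertex $u_\gamma$ and every edge $e$ of $X$ starting at the end of $\gamma$; and with a face for every face $\sigma$ of $X$ and every vertex over the start $\alpha_\sigma(0)$ of the boundary path of $\sigma$, attached along the lift of that path. It is pointed at the class $x$ of the trivial path and projects to $X$ in the evident way. **Theorem (Galois correspondence).** Let $X$ be a connected $2$-complex and $v$ a vertex of $X$. Then $\mathcal L(X_v)$ is a lattice, and the map $$\Phi:\mathcal L(X_v)\to\{\text{subgroups of }\pi_1(X,v)\},\qquad [f:Y_y\to X_v]\mapsto f_*\pi_1(Y,y),$$ is well defined and is a lattice anti-isomorphism (an order-reversing bijection with order-reversing inverse), the subgroups being ordered by inclusion. Its inverse sends $H$ to the class of $(X{\uparrow}H)_x\to X_v$. Moreover, Galois coverings correspond to normal subgroups: for every pointed covering $f:Y_y\to X_v$ and every vertex $w$ of $X$, the group of isomorphisms $a:Y\to Y$ with $fa=f$ acts regularly (simply transitively) on the vertices of $Y$ over $w$ if and only if $f_*\pi_1(Y,y)$ is normal in $\pi_1(X,v)$. -/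

import Mathlib

universe u w w'

namespace CombTop

/-! ## Graphs (1-complexes) and their dimension preserving maps -/

/-- A graph: vertices, (oriented) edges, start vertices, and an inversion of the edges that is an
involution without fixed points. -/
structure SGraph where
  V : Type u
  E : Type u
  src : E → V
  inv : E → E
  inv_inv : ∀ e, inv (inv e) = e
  inv_ne : ∀ e, inv e ≠ e

/-- The terminal vertex of an edge. -/
def SGraph.tgt (G : SGraph.{u}) (e : G.E) : G.V := G.src (G.inv e)

/-- A dimension preserving map of graphs: vertices go to vertices and edges to edges,
compatibly with start vertices and inversion. -/
@[ext]
structure GraphHom (G : SGraph.{u}) (H : SGraph.{w}) where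
  mapV : G.V → H.V
  mapE : G.E → H.E
  src_map : ∀ e, H.src (mapE e) = mapV (G.src e)
  inv_map : ∀ e, mapE (G.inv e) = H.inv (mapE e)

namespace GraphHom

def id (G : SGraph.{u}) : GraphHom G G where
  mapV := fun x => x
  mapE := fun e => e
  src_map := fun _ => rfl
  inv_map := fun _ => rfl

def comp {G : SGraph.{u}} {H : SGraph.{w}} {K : SGraph.{w'}} (g : GraphHom H K)
    (f : GraphHom G H) : GraphHom G K where
  mapV := fun x => g.mapV (f.mapV x)
  mapE := fun e => g.mapE (f.mapE e)
  src_map := fun e => by rw [g.src_map, f.src_map]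
  inv_map := fun e => by rw [f.inv_map, g.inv_map]

theorem tgt_map {G : SGraph.{u}} {H : SGraph.{w}} (f : GraphHom G H) (e : G.E) :
    H.tgt (f.mapE e) = f.mapV (G.tgt e) := by
  unfold SGraph.tgt
  rw [← f.inv_map, f.src_map]

end GraphHom

/-! ## The 1-sphere of length `n` -/

/-- The edges of the 1-sphere of length `n`: for `n ≠ 0`, the edge `⟨i, true⟩` runs from the
vertex `i` to the vertex `i + 1`, and `⟨i, false⟩` is its inverse. For `n = 0` there are none. -/
@[ext]
structure CircleEdge (n : ℕ) where
  idx : ZMod (max n 1)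
  fwd : Bool
  pos : n ≠ 0

/-- The 1-sphere of length `n`: the oriented `n`-cycle with vertices `0, …, n - 1` when `n ≥ 1`, and
the trivial graph (one vertex, no edge) when `n = 0`. Its standard orientation consists of the
edges with `fwd = true`. -/
def circle (n : ℕ) : SGraph.{0} where
  V := ZMod (max n 1)
  E := CircleEdge n
  src := fun c => if c.fwd then c.idx else c.idx + 1
  inv := fun c => ⟨c.idx, !c.fwd, c.pos⟩
  inv_inv := fun c => by cases c; simp
  inv_ne := fun c h => by
    have := congrArg CircleEdge.fwd h
    simp at this

/-- The orientation reversing map `ι` of the 1-sphere that fixes the vertex `0`. It sends the vertex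
`i` to `-i` and interchanges the `i`-th edge from the front with the inverse of the `i`-th edge
from the back. (The lengths are only required to be provably equal.) -/
def circleFlip {m n : ℕ} (h : m = n) : GraphHom (circle m) (circle n) where
  mapV := fun (x : ZMod (max m 1)) => ((h ▸ (-x)) : ZMod (max n 1))
  mapE := fun (c : CircleEdge m) => ((h ▸ (⟨-c.idx - 1, !c.fwd, c.pos⟩ : CircleEdge m)) :
    CircleEdge n)
  src_map := by
    subst h
    rintro ⟨i, b, hp⟩
    cases b
    · simp [circle]; ring
    · simp [circle]
  inv_map := by
    subst h
    rintro ⟨i, b, hp⟩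
    simp [circle]

/-- Orientation preserving isomorphisms of 1-spheres. -/
structure IsCircleIso {m n : ℕ} (ε : GraphHom (circle m) (circle n)) : Prop where
  bijV : Function.Bijective ε.mapV
  bijE : Function.Bijective ε.mapE
  fwd_map : ∀ c : CircleEdge m, (ε.mapE c : CircleEdge n).fwd = c.fwd

/-! ## 2-complexes, their dimension preserving maps, coverings -/

/-- A combinatorial 2-complex: a graph together with faces `σ`, each having as boundary a 1-sphere
(of length `len σ`) with a dimension preserving attaching map, and an inversion of the faces, an
involution without fixed points, such that the attaching map of the inverse face is the attaching
map of the face precomposed with `ι`. -/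
structure TwoComplex extends SGraph.{u} where
  F : Type u
  len : F → ℕ
  att : ∀ σ, GraphHom (circle (len σ)) toSGraph
  finv : F → F
  finv_finv : ∀ σ, finv (finv σ) = σ
  finv_ne : ∀ σ, finv σ ≠ σ
  len_finv : ∀ σ, len (finv σ) = len σ
  att_finv : ∀ σ, att (finv σ) = (att σ).comp (circleFlip (len_finv σ))

/-- A dimension preserving map of 2-complexes: a dimension preserving map of the 1-skeleta, a map of
the faces, and for every face `σ` an orientation preserving isomorphism `ε(f, σ)` from the boundary
sphere of `σ` to that of `f σ` that commutes with the attaching maps; all this is compatible with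
the inversion of faces. Two such maps are equal if they agree on all cells and have the same
`ε(f, σ)`. -/
structure TwoComplex.Hom (Y : TwoComplex.{u}) (X : TwoComplex.{u}) extends
    GraphHom Y.toSGraph X.toSGraph where
  mapF : Y.F → X.F
  eps : ∀ σ, GraphHom (circle (Y.len σ)) (circle (X.len (mapF σ)))
  eps_iso : ∀ σ, IsCircleIso (eps σ)
  att_comm : ∀ σ, toGraphHom.comp (Y.att σ) = (X.att (mapF σ)).comp (eps σ)
  mapF_finv : ∀ σ, mapF (Y.finv σ) = X.finv (mapF σ)
  eps_finv : ∀ σ, (circleFlip ((congrArg X.len (mapF_finv σ)).trans (X.len_finv (mapF σ)))).comp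
    (eps (Y.finv σ)) = (eps σ).comp (circleFlip (Y.len_finv σ))

namespace TwoComplex

/-- A corner of `X`: a face `σ` together with a vertex of its boundary sphere. The corner is *at*
the vertex `v` of `X` if the attaching map sends it to `v`, so the corners `⟨σ, x⟩` at `v` are the
appearances of `v` in the boundary of `σ`. -/
abbrev Corner (X : TwoComplex.{u}) : Type u := Σ σ : X.F, (circle (X.len σ)).V

def Corner.at {X : TwoComplex.{u}} (c : X.Corner) : X.V := (X.att c.1).mapV c.2

namespace Hom

variable {Y X Z : TwoComplex.{u}}

/-- The disjoint union of the maps `ε(f, σ)` on the vertices of the boundary spheres. -/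
def cornerMap (f : Hom Y X) (c : Y.Corner) : X.Corner := ⟨f.mapF c.1, (f.eps c.1).mapV c.2⟩

theorem cornerMap_at (f : Hom Y X) (c : Y.Corner) : (f.cornerMap c).at = f.mapV c.at :=
  (congrArg (fun φ => GraphHom.mapV φ c.2) (f.att_comm c.1)).symm

/-- Local continuity on edges: the map from the edges starting at `y` to those starting at
`f y`. -/
def localE (f : Hom Y X) (y : Y.V) (e : {e : Y.E // Y.src e = y}) :
    {e : X.E // X.src e = f.mapV y} :=
  ⟨f.mapE e.1, by rw [f.src_map, e.2]⟩

/-- Local continuity on faces, taken for all faces `τ` of `X` at once: the map from the corners at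
`y` to the corners at `f y`. As a corner in `σ` goes to a corner in `f σ`, it is the disjoint
union over `τ` of the maps `⋃_{f σ = τ} α_σ⁻¹(y) → α_τ⁻¹(f y)`, so it is bijective if and
only if each of these is. -/
def localF (f : Hom Y X) (y : Y.V) (c : {c : Y.Corner // c.at = y}) :
    {c : X.Corner // c.at = f.mapV y} :=
  ⟨f.cornerMap c.1, by rw [f.cornerMap_at, c.2]⟩

/-- A covering: a dimension preserving map all of whose local continuity maps are bijections. -/
structure IsCovering (f : Hom Y X) : Prop where
  edges : ∀ y, Function.Bijective (f.localE y)
  faces : ∀ y, Function.Bijective (f.localF y)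

/-- An isomorphism: a dimension preserving map that is bijective on vertices, edges and faces. -/
structure IsIso (f : Hom Y X) : Prop where
  bijV : Function.Bijective f.mapV
  bijE : Function.Bijective f.mapE
  bijF : Function.Bijective f.mapF

theorem circle_id_iso (n : ℕ) : IsCircleIso (GraphHom.id (circle n)) :=
  ⟨Function.bijective_id, Function.bijective_id, fun _ => rfl⟩

def id (X : TwoComplex.{u}) : Hom X X where
  toGraphHom := GraphHom.id X.toSGraph
  mapF := fun σ => σ
  eps := fun _ => GraphHom.id _
  eps_iso := fun _ => circle_id_iso _
  att_comm := fun _ => rfl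
  mapF_finv := fun _ => rfl
  eps_finv := fun _ => rfl

/-- Composition, with `ε(g f, σ) = ε(g, f σ) ε(f, σ)`. -/
def comp (g : Hom X Z) (f : Hom Y X) : Hom Y Z where
  toGraphHom := g.toGraphHom.comp f.toGraphHom
  mapF := fun σ => g.mapF (f.mapF σ)
  eps := fun σ => (g.eps (f.mapF σ)).comp (f.eps σ)
  eps_iso := fun σ =>
    ⟨(g.eps_iso _).bijV.comp (f.eps_iso σ).bijV, (g.eps_iso _).bijE.comp (f.eps_iso σ).bijE,
      fun c => ((g.eps_iso _).fwd_map _).trans ((f.eps_iso σ).fwd_map c)⟩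
  att_comm := fun σ => by
    have h1 := f.att_comm σ
    have h2 := g.att_comm (f.mapF σ)
    calc (g.toGraphHom.comp f.toGraphHom).comp (Y.att σ)
        = g.toGraphHom.comp (f.toGraphHom.comp (Y.att σ)) := rfl
      _ = (g.toGraphHom.comp (X.att (f.mapF σ))).comp (f.eps σ) := by rw [h1]; rfl
      _ = _ := by rw [h2]; rfl
  mapF_finv := fun σ => by rw [f.mapF_finv, g.mapF_finv]
  eps_finv := fun σ => by
    have key : ∀ (τ' τ : X.F) (h : τ' = X.finv τ) (h1 : Z.len (g.mapF τ') = Z.len (g.mapF τ))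
        (h2 : X.len τ' = X.len τ),
        (circleFlip h1).comp (g.eps τ') = (g.eps τ).comp (circleFlip h2) := by
      intro τ' τ h h1 h2
      subst h
      exact g.eps_finv τ
    have h2 : X.len (f.mapF (Y.finv σ)) = X.len (f.mapF σ) :=
      (congrArg X.len (f.mapF_finv σ)).trans (X.len_finv (f.mapF σ))
    have h1 : Z.len (g.mapF (f.mapF (Y.finv σ))) = Z.len (g.mapF (f.mapF σ)) := by
      rw [f.mapF_finv, g.mapF_finv, Z.len_finv]
    have k := key _ _ (f.mapF_finv σ) h1 h2
    have e := f.eps_finv σ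
    calc (circleFlip h1).comp ((g.eps (f.mapF (Y.finv σ))).comp (f.eps (Y.finv σ)))
        = ((circleFlip h1).comp (g.eps (f.mapF (Y.finv σ)))).comp (f.eps (Y.finv σ)) := rfl
      _ = (g.eps (f.mapF σ)).comp ((circleFlip h2).comp (f.eps (Y.finv σ))) := by rw [k]; rfl
      _ = _ := by rw [e]; rfl

theorem comp_cornerMap (g : Hom X Z) (f : Hom Y X) (c : Y.Corner) :
    (g.comp f).cornerMap c = g.cornerMap (f.cornerMap c) := rfl

end Hom

/-! ## Paths, homotopy, the fundamental group -/

end TwoComplex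

/-- `IsPath G a l b`: the edges in the list `l` are consecutively incident and run from `a`
to `b`. -/
def IsPath (G : SGraph.{u}) : G.V → List G.E → G.V → Prop
  | a, [], b => a = b
  | a, e :: l, b => G.src e = a ∧ IsPath G (G.tgt e) l b

/-- A path from `a` to `b`. -/
@[ext]
structure GPath (G : SGraph.{u}) (a b : G.V) where
  edges : List G.E
  isPath : IsPath G a edges b

theorem isPath_append {G : SGraph.{u}} {a b c : G.V} {l m : List G.E} (h : IsPath G a l b)
    (k : IsPath G b m c) : IsPath G a (l ++ m) c := by
  induction l generalizing a with
  | nil => cases h; exact k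
  | cons e l ih => exact ⟨h.1, ih h.2⟩

theorem isPath_split {G : SGraph.{u}} {a c : G.V} {l m : List G.E} (h : IsPath G a (l ++ m) c) :
    ∃ b, IsPath G a l b ∧ IsPath G b m c := by
  induction l generalizing a with
  | nil => exact ⟨a, rfl, h⟩
  | cons e l ih =>
    obtain ⟨b, h1, h2⟩ := ih h.2
    exact ⟨b, ⟨h.1, h1⟩, h2⟩

theorem isPath_end_unique {G : SGraph.{u}} {a b c : G.V} {l : List G.E} (h : IsPath G a l b)
    (k : IsPath G a l c) : b = c := by
  induction l generalizing a with
  | nil => exact h.symm.trans k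
  | cons e l ih => exact ih h.2 k.2

/-- The inverse of a list of edges: the inverse edges in reverse order. -/
def revEdges (G : SGraph.{u}) (l : List G.E) : List G.E := (l.map G.inv).reverse

theorem revEdges_append (G : SGraph.{u}) (l m : List G.E) :
    revEdges G (l ++ m) = revEdges G m ++ revEdges G l := by simp [revEdges]

theorem revEdges_revEdges (G : SGraph.{u}) (l : List G.E) : revEdges G (revEdges G l) = l := by
  have : G.inv ∘ G.inv = fun e => e := funext G.inv_inv
  simp [revEdges, List.map_reverse, this]

theorem isPath_rev {G : SGraph.{u}} {a b : G.V} {l : List G.E} (h : IsPath G a l b) :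
    IsPath G b (revEdges G l) a := by
  induction l generalizing a with
  | nil => exact Eq.symm h
  | cons e l ih =>
    have h1 := ih h.2
    have : revEdges G (e :: l) = revEdges G l ++ [G.inv e] := by simp [revEdges]
    rw [this]
    refine isPath_append h1 ⟨rfl, ?_⟩
    show G.src (G.inv (G.inv e)) = a
    rw [G.inv_inv, h.1]

theorem isPath_map {G : SGraph.{u}} {H : SGraph.{w}} (f : GraphHom G H) {a b : G.V}
    {l : List G.E} (h : IsPath G a l b) :
    IsPath H (f.mapV a) (l.map f.mapE) (f.mapV b) := by
  induction l generalizing a with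
  | nil => exact congrArg f.mapV h
  | cons e l ih =>
    refine ⟨by rw [f.src_map, h.1], ?_⟩
    rw [f.tgt_map]
    exact ih h.2

namespace GPath

variable {G : SGraph.{u}} {a b c : G.V}

def nil (a : G.V) : GPath G a a := ⟨[], rfl⟩

def trans (p : GPath G a b) (q : GPath G b c) : GPath G a c :=
  ⟨p.edges ++ q.edges, isPath_append p.isPath q.isPath⟩

def symm (p : GPath G a b) : GPath G b a := ⟨revEdges G p.edges, isPath_rev p.isPath⟩

end GPath

namespace TwoComplex

/-- The closed path once around the boundary of the face `σ`, along its orientation, starting at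
the vertex `x` of its boundary sphere. -/
def boundaryPath (X : TwoComplex.{u}) (σ : X.F) (x : ZMod (max (X.len σ) 1)) : List X.E :=
  List.ofFn fun j : Fin (X.len σ) =>
    (X.att σ).mapE (⟨x + (j : ℕ), true, Nat.ne_zero_of_lt j.2⟩ : CircleEdge (X.len σ))

variable {X : TwoComplex.{u}}

/-- An elementary homotopy: `q` is obtained from `p` by inserting a spur or the boundary of a face
(incidence being preserved, as both are paths from `a` to `b`). -/
def HomotopyStep {a b : X.V} (p q : GPath X.toSGraph a b) : Prop :=
  ∃ l₁ m l₂ : List X.E, p.edges = l₁ ++ l₂ ∧ q.edges = l₁ ++ m ++ l₂ ∧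
    ((∃ e, m = [e, X.inv e]) ∨ ∃ σ x, m = X.boundaryPath σ x)

/-- Homotopy of paths: a finite sequence of insertions and deletions of spurs and face
boundaries. -/
def Homotopic {a b : X.V} : GPath X.toSGraph a b → GPath X.toSGraph a b → Prop :=
  Relation.EqvGen HomotopyStep

theorem Homotopic.refl {a b : X.V} (p : GPath X.toSGraph a b) : Homotopic p p :=
  Relation.EqvGen.refl p

theorem Homotopic.symm {a b : X.V} {p q : GPath X.toSGraph a b} (h : Homotopic p q) :
    Homotopic q p := Relation.EqvGen.symm _ _ h

theorem Homotopic.trans {a b : X.V} {p q r : GPath X.toSGraph a b} (h : Homotopic p q)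
    (k : Homotopic q r) : Homotopic p r := Relation.EqvGen.trans _ _ _ h k

theorem Homotopic.transport {Y : TwoComplex.{u}} {a b : X.V} {c d : Y.V}
    (φ : GPath X.toSGraph a b → GPath Y.toSGraph c d)
    (hφ : ∀ p q, HomotopyStep p q → Homotopic (φ p) (φ q))
    {p q : GPath X.toSGraph a b} (h : Homotopic p q) : Homotopic (φ p) (φ q) := by
  induction h with
  | rel p q h => exact hφ p q h
  | refl p => exact Homotopic.refl _
  | symm p q _ ih => exact ih.symm
  | trans p q r _ _ ih1 ih2 => exact ih1.trans ih2

theorem Homotopic.trans_left {a b c : X.V} (r : GPath X.toSGraph a b)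
    {p q : GPath X.toSGraph b c} (h : Homotopic p q) : Homotopic (r.trans p) (r.trans q) := by
  refine h.transport (fun p => r.trans p) ?_
  rintro p q ⟨l₁, m, l₂, hp, hq, hm⟩
  exact Relation.EqvGen.rel _ _
    ⟨r.edges ++ l₁, m, l₂, by simp [GPath.trans, hp], by simp [GPath.trans, hq], hm⟩

theorem Homotopic.trans_right {a b c : X.V} (r : GPath X.toSGraph b c)
    {p q : GPath X.toSGraph a b} (h : Homotopic p q) : Homotopic (p.trans r) (q.trans r) := by
  refine h.transport (fun p => p.trans r) ?_
  rintro p q ⟨l₁, m, l₂, hp, hq, hm⟩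
  exact Relation.EqvGen.rel _ _
    ⟨l₁, m, l₂ ++ r.edges, by simp [GPath.trans, hp], by simp [GPath.trans, hq], hm⟩

theorem homotopic_trans_symm {a b : X.V} (p : GPath X.toSGraph a b) :
    Homotopic (p.trans p.symm) (GPath.nil a) := by
  obtain ⟨l, hl⟩ := p
  induction l using List.reverseRecOn generalizing b with
  | nil => exact Homotopic.refl _
  | append_singleton l e ih =>
    obtain ⟨c, h1, h2⟩ := isPath_split hl
    refine Homotopic.trans ?_ (ih h1)
    refine Homotopic.symm (Relation.EqvGen.rel _ _
      ⟨l, [e, X.inv e], revEdges _ l, rfl, ?_, Or.inl ⟨e, rfl⟩⟩)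
    simp [GPath.trans, GPath.symm, revEdges]

theorem homotopic_symm_trans {a b : X.V} (p : GPath X.toSGraph a b) :
    Homotopic (p.symm.trans p) (GPath.nil b) := by
  have h := homotopic_trans_symm p.symm
  have : p.symm.symm = p := GPath.ext (revEdges_revEdges _ _)
  rwa [this] at h

theorem Homotopic.inv {a b : X.V} {p q : GPath X.toSGraph a b} (h : Homotopic p q) :
    Homotopic p.symm q.symm := by
  have h1 : Homotopic p.symm ((p.symm.trans q).trans q.symm) := by
    have := Homotopic.trans_left p.symm (homotopic_trans_symm q).symm
    have e1 : p.symm.trans (GPath.nil a) = p.symm := GPath.ext (by simp [GPath.trans, GPath.nil])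
    have e2 : p.symm.trans (q.trans q.symm) = (p.symm.trans q).trans q.symm :=
      GPath.ext (by simp [GPath.trans])
    rwa [e1, e2] at this
  have h2 : Homotopic ((p.symm.trans q).trans q.symm) ((GPath.nil b).trans q.symm) :=
    Homotopic.trans_right _ ((Homotopic.trans_left p.symm h.symm).trans (homotopic_symm_trans p))
  exact h1.trans h2

/-- Homotopy of closed paths at `v`. -/
def homotopySetoid (X : TwoComplex.{u}) (v : X.V) : Setoid (GPath X.toSGraph v v) :=
  ⟨Homotopic, ⟨Homotopic.refl, Homotopic.symm, Homotopic.trans⟩⟩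

/-- The fundamental group: homotopy classes of closed paths at `v`, multiplied by
concatenation. -/
def Pi1 (X : TwoComplex.{u}) (v : X.V) : Type u := Quotient (homotopySetoid X v)

/-- The homotopy class of a closed path. -/
def Pi1.mk {v : X.V} (p : GPath X.toSGraph v v) : Pi1 X v := Quotient.mk (homotopySetoid X v) p

theorem Pi1.mk_eq {v : X.V} {p q : GPath X.toSGraph v v} : Pi1.mk p = Pi1.mk q ↔ Homotopic p q :=
  ⟨fun h => Quotient.exact h, fun h => Quotient.sound h⟩

instance (v : X.V) : Group (Pi1 X v) where
  mul := Quotient.map₂ GPath.trans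
    (fun _ q h r _ k => (Homotopic.trans_right r h).trans (Homotopic.trans_left q k))
  one := Pi1.mk (GPath.nil v)
  inv := Quotient.map GPath.symm (fun _ _ h => Homotopic.inv h)
  mul_assoc := by
    rintro ⟨p⟩ ⟨q⟩ ⟨r⟩
    exact congrArg Pi1.mk (GPath.ext (List.append_assoc _ _ _))
  one_mul := by
    rintro ⟨p⟩
    exact congrArg Pi1.mk (GPath.ext (List.nil_append _))
  mul_one := by
    rintro ⟨p⟩
    exact congrArg Pi1.mk (GPath.ext (List.append_nil _))
  inv_mul_cancel := by
    rintro ⟨p⟩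
    exact Pi1.mk_eq.2 (homotopic_symm_trans p)

theorem Pi1.mk_mul {v : X.V} (p q : GPath X.toSGraph v v) :
    Pi1.mk p * Pi1.mk q = Pi1.mk (p.trans q) := rfl

theorem Pi1.mk_inv {v : X.V} (p : GPath X.toSGraph v v) : (Pi1.mk p)⁻¹ = Pi1.mk p.symm := rfl

/-- A complex is connected if any two vertices are joined by a path. -/
def Connected (X : TwoComplex.{u}) : Prop := ∀ a b : X.V, Nonempty (GPath X.toSGraph a b)

/-! ## The homomorphism induced on fundamental groups -/

end TwoComplex

/-- The action of a map of 1-spheres on the vertices, with the vertices seen as integers mod the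
lengths. -/
abbrev circV {m n : ℕ} (ε : GraphHom (circle m) (circle n)) (x : ZMod (max m 1)) :
    ZMod (max n 1) := ε.mapV x

theorem IsCircleIso.len_eq {m n : ℕ} {ε : GraphHom (circle m) (circle n)} (h : IsCircleIso ε) :
    m = n := by
  have : NeZero (max m 1) := ⟨by omega⟩
  have : NeZero (max n 1) := ⟨by omega⟩
  have h1 : max m 1 = max n 1 := by
    have := Nat.card_congr (Equiv.ofBijective _ h.bijV)
    simpa [circle, Nat.card_zmod] using this
  by_cases hm : m = 0
  · by_cases hn : n = 0
    · omega
    · obtain ⟨c, -⟩ := h.bijE.2 (⟨0, true, hn⟩ : CircleEdge n)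
      exact absurd hm (CircleEdge.pos c)
  · by_cases hn : n = 0
    · exact absurd hn (CircleEdge.pos (ε.mapE (⟨0, true, hm⟩ : CircleEdge m)))
    · omega

theorem IsCircleIso.mapE_idx {m n : ℕ} {ε : GraphHom (circle m) (circle n)} (h : IsCircleIso ε)
    (x : ZMod (max m 1)) (hm : m ≠ 0) (hn : n ≠ 0) :
    ε.mapE (⟨x, true, hm⟩ : CircleEdge m) =
      (⟨circV ε x, true, hn⟩ : CircleEdge n) := by
  have h1 : (ε.mapE (⟨x, true, hm⟩ : CircleEdge m) : CircleEdge n).fwd = true := h.fwd_map _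
  have h2 := ε.src_map (⟨x, true, hm⟩ : CircleEdge m)
  refine CircleEdge.ext ?_ h1
  simpa [circle, h1] using h2

theorem IsCircleIso.mapV_add {m n : ℕ} {ε : GraphHom (circle m) (circle n)} (h : IsCircleIso ε)
    (x : ZMod (max m 1)) (k : ℕ) (hm : m ≠ 0) :
    circV ε (x + (k : ZMod (max m 1))) = circV ε x + (k : ZMod (max n 1)) := by
  have hn : n ≠ 0 := h.len_eq ▸ hm
  induction k with
  | zero => simp
  | succ k ih =>
    have h1 := ε.tgt_map (⟨x + (k : ZMod (max m 1)), true, hm⟩ : CircleEdge m)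
    rw [h.mapE_idx _ hm hn] at h1
    have h2 : circV ε (x + (k : ZMod (max m 1))) + 1 = circV ε (x + (k : ZMod (max m 1)) + 1) := by
      simpa [circle, SGraph.tgt] using h1
    rw [ih] at h2
    push_cast
    rw [← add_assoc, ← add_assoc]
    exact h2.symm

namespace TwoComplex

variable {X Y Z : TwoComplex.{u}}

theorem Hom.map_boundaryPath (f : Hom Y X) (σ : Y.F) (x : ZMod (max (Y.len σ) 1)) :
    (Y.boundaryPath σ x).map f.mapE = X.boundaryPath (f.mapF σ) (circV (f.eps σ) x) := by
  have hl : Y.len σ = X.len (f.mapF σ) := (f.eps_iso σ).len_eq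
  refine List.ext_getElem (by simp [boundaryPath, hl]) ?_
  intro i h1 h2
  have hi : i < Y.len σ := by simpa [boundaryPath] using h1
  have hm : Y.len σ ≠ 0 := Nat.ne_zero_of_lt hi
  have hn : X.len (f.mapF σ) ≠ 0 := hl ▸ hm
  have e1 := (f.eps_iso σ).mapE_idx (x + (i : ℕ)) hm hn
  have e2 := (f.eps_iso σ).mapV_add x i hm
  have e3 := congrArg (fun φ => GraphHom.mapE φ
    (⟨x + (i : ℕ), true, hm⟩ : CircleEdge (Y.len σ))) (f.att_comm σ)
  simp only [boundaryPath, List.getElem_map, List.getElem_ofFn]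
  refine e3.trans ?_
  show (X.att (f.mapF σ)).mapE ((f.eps σ).mapE _) = _
  rw [e1, e2]

/-- The image of a path. -/
def Hom.mapPath (f : Hom Y X) {a b : Y.V} {a' b' : X.V} (ha : f.mapV a = a') (hb : f.mapV b = b')
    (p : GPath Y.toSGraph a b) : GPath X.toSGraph a' b' :=
  ⟨p.edges.map f.mapE, ha ▸ hb ▸ isPath_map f.toGraphHom p.isPath⟩

theorem Hom.mapPath_homotopic (f : Hom Y X) {a b : Y.V} {a' b' : X.V} (ha : f.mapV a = a')
    (hb : f.mapV b = b') {p q : GPath Y.toSGraph a b} (h : Homotopic p q) :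
    Homotopic (f.mapPath ha hb p) (f.mapPath ha hb q) := by
  refine h.transport (f.mapPath ha hb) ?_
  rintro p q ⟨l₁, m, l₂, hp, hq, hm⟩
  refine Relation.EqvGen.rel _ _ ⟨l₁.map f.mapE, m.map f.mapE, l₂.map f.mapE,
    by simp [Hom.mapPath, hp], by simp [Hom.mapPath, hq], ?_⟩
  rcases hm with ⟨e, rfl⟩ | ⟨σ, x, rfl⟩
  · exact Or.inl ⟨f.mapE e, by simp [f.inv_map]⟩
  · exact Or.inr ⟨f.mapF σ, circV (f.eps σ) x, f.map_boundaryPath σ x⟩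

/-- The induced homomorphism `f_* : π₁(Y, y) → π₁(X, v)`, where `f y = v`. -/
def Hom.pi1Map (f : Hom Y X) {y : Y.V} {v : X.V} (h : f.mapV y = v) : Pi1 Y y →* Pi1 X v where
  toFun := Quotient.map (f.mapPath h h) (fun _ _ k => f.mapPath_homotopic h h k)
  map_one' := rfl
  map_mul' := by
    rintro ⟨p⟩ ⟨q⟩
    exact congrArg Pi1.mk (GPath.ext (by simp [Hom.mapPath, GPath.trans]))

/-! ## Pointed connected coverings and their equivalence classes -/

/-- A pointed covering `proj : cover_base → X_v` with connected `cover`. -/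
structure PointedCover (X : TwoComplex.{u}) (v : X.V) where
  cover : TwoComplex.{u}
  base : cover.V
  proj : Hom cover X
  connected : cover.Connected
  isCovering : proj.IsCovering
  proj_base : proj.mapV base = v

/-- The subgroup `f_* π₁(Y, y)` of `π₁(X, v)` given by a pointed covering `f : Y_y → X_v`. -/
def PointedCover.subgroup {v : X.V} (c : PointedCover X v) : Subgroup (Pi1 X v) :=
  (c.proj.pi1Map c.proj_base).range

/-- Two pointed coverings are equivalent if there is a pointed isomorphism between them that
commutes with the projections to `X`. -/
def PointedCover.Equivalent {v : X.V} (c d : PointedCover X v) : Prop :=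
  ∃ g : Hom c.cover d.cover, g.IsIso ∧ g.mapV c.base = d.base ∧ d.proj.comp g = c.proj

/-- The order on pointed coverings: `c ≤ d` if `d` covers `c`, by a pointed covering that commutes
with the projections to `X`. -/
def PointedCover.Le {v : X.V} (c d : PointedCover X v) : Prop :=
  ∃ g : Hom d.cover c.cover, g.IsCovering ∧ g.mapV d.base = c.base ∧ c.proj.comp g = d.proj

/-- The covering `f : Y → X` is Galois via the vertex `x` of `X`: the Galois group, that is, the
group of isomorphisms `a : Y → Y` with `f a = f`, acts regularly (simply transitively) on the
vertices of `Y` in the fiber of `x`. -/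
def Hom.IsGaloisVia (f : Hom Y X) (x : X.V) : Prop :=
  ∀ y₁ y₂ : Y.V, f.mapV y₁ = x → f.mapV y₂ = x →
    ∃! a : Hom Y Y, (a.IsIso ∧ f.comp a = f) ∧ a.mapV y₁ = y₂

/-! ## Inverses of isomorphisms, composites of coverings, and the poset of classes -/

theorem Hom.ext_heq {f g : Hom Y X} (h1 : f.toGraphHom = g.toGraphHom) (h2 : f.mapF = g.mapF)
    (h3 : ∀ σ, HEq (f.eps σ) (g.eps σ)) : f = g := by
  cases f with
  | mk fG fF fe _ _ _ _ =>
  cases g with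
  | mk gG gF ge _ _ _ _ =>
  dsimp only at h1 h2 h3
  subst h1 h2
  have : fe = ge := funext fun σ => eq_of_heq (h3 σ)
  subst this
  rfl

/-- The inverse of a bijective map of graphs. -/
noncomputable def _root_.CombTop.GraphHom.inverse {G : SGraph.{u}} {H : SGraph.{w}}
    (f : GraphHom G H)
    (hV : Function.Bijective f.mapV) (hE : Function.Bijective f.mapE) : GraphHom H G where
  mapV := (Equiv.ofBijective _ hV).symm
  mapE := (Equiv.ofBijective _ hE).symm
  src_map := fun e => by
    obtain ⟨e, rfl⟩ := hE.2 e
    rw [Equiv.ofBijective_symm_apply_apply, f.src_map, Equiv.ofBijective_symm_apply_apply]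
  inv_map := fun e => by
    obtain ⟨e, rfl⟩ := hE.2 e
    rw [← f.inv_map, Equiv.ofBijective_symm_apply_apply, Equiv.ofBijective_symm_apply_apply]

theorem _root_.CombTop.GraphHom.comp_inverse {G : SGraph.{u}} {H : SGraph.{w}} (f : GraphHom G H)
    (hV : Function.Bijective f.mapV) (hE : Function.Bijective f.mapE) :
    f.comp (f.inverse hV hE) = GraphHom.id H :=
  GraphHom.ext (funext fun x => Equiv.ofBijective_apply_symm_apply _ hV x)
    (funext fun x => Equiv.ofBijective_apply_symm_apply _ hE x)

theorem _root_.CombTop.GraphHom.inverse_comp {G : SGraph.{u}} {H : SGraph.{w}} (f : GraphHom G H)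
    (hV : Function.Bijective f.mapV) (hE : Function.Bijective f.mapE) :
    (f.inverse hV hE).comp f = GraphHom.id G :=
  GraphHom.ext (funext fun x => Equiv.ofBijective_symm_apply_apply _ hV x)
    (funext fun x => Equiv.ofBijective_symm_apply_apply _ hE x)

theorem Hom.IsIso.exists_inverse {g : Hom Y X} (hg : g.IsIso) :
    ∃ h : Hom X Y, h.IsIso ∧ g.comp h = Hom.id X := by
  classical
  set G := g.toGraphHom.inverse hg.bijV hg.bijE with hG
  have hGg : G.comp g.toGraphHom = GraphHom.id _ := g.toGraphHom.inverse_comp _ _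
  have hgG : g.toGraphHom.comp G = GraphHom.id _ := g.toGraphHom.comp_inverse _ _
  set F := (Equiv.ofBijective _ hg.bijF).symm with hF
  have hFg : ∀ τ, g.mapF (F τ) = τ := fun τ => Equiv.ofBijective_apply_symm_apply _ hg.bijF τ
  have hgF : ∀ σ, F (g.mapF σ) = σ := fun σ => Equiv.ofBijective_symm_apply_apply _ hg.bijF σ
  let E : ∀ σ, GraphHom (circle (X.len (g.mapF σ))) (circle (Y.len σ)) := fun σ =>
    (g.eps σ).inverse (g.eps_iso σ).bijV (g.eps_iso σ).bijE
  have hE1 : ∀ σ, (g.eps σ).comp (E σ) = GraphHom.id _ := fun σ => GraphHom.comp_inverse _ _ _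
  have hE2 : ∀ σ, (E σ).comp (g.eps σ) = GraphHom.id _ := fun σ => GraphHom.inverse_comp _ _ _
  have hEiso : ∀ σ, IsCircleIso (E σ) := fun σ =>
    ⟨(Equiv.ofBijective _ (g.eps_iso σ).bijV).symm.bijective,
      (Equiv.ofBijective _ (g.eps_iso σ).bijE).symm.bijective, fun c => by
        obtain ⟨c, rfl⟩ := (g.eps_iso σ).bijE.2 c
        refine Eq.trans ?_ ((g.eps_iso σ).fwd_map c).symm
        exact congrArg CircleEdge.fwd (Equiv.ofBijective_symm_apply_apply _ (g.eps_iso σ).bijE c)⟩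
  let C : ∀ (σ : Y.F) (τ : X.F), g.mapF σ = τ →
      GraphHom (circle (X.len τ)) (circle (Y.len σ)) := fun σ τ h => h ▸ E σ
  have hCiso : ∀ σ τ h, IsCircleIso (C σ τ h) := by
    intro σ τ h
    subst h
    exact hEiso σ
  have hCatt : ∀ σ τ h, G.comp (X.att τ) = (Y.att σ).comp (C σ τ h) := by
    intro σ τ h
    subst h
    calc G.comp (X.att (g.mapF σ))
        = G.comp ((X.att (g.mapF σ)).comp ((g.eps σ).comp (E σ))) := by rw [hE1]; rfl
      _ = G.comp (((X.att (g.mapF σ)).comp (g.eps σ)).comp (E σ)) := rfl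
      _ = (G.comp g.toGraphHom).comp ((Y.att σ).comp (E σ)) := by rw [← g.att_comm]; rfl
      _ = _ := by rw [hGg]; rfl
  have hCinv : ∀ σ τ (h : g.mapF σ = τ) σ' τ' (h' : g.mapF σ' = τ') (_ : σ' = Y.finv σ)
      (l1 : Y.len σ' = Y.len σ) (l2 : X.len τ' = X.len τ),
      (circleFlip l1).comp (C σ' τ' h') = (C σ τ h).comp (circleFlip l2) := by
    intro σ τ h σ' τ' h' hσ l1 l2
    subst hσ
    subst h
    subst h'
    have e := g.eps_finv σ
    calc (circleFlip l1).comp (E (Y.finv σ))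
        = ((E σ).comp (g.eps σ)).comp ((circleFlip l1).comp (E (Y.finv σ))) := by rw [hE2]; rfl
      _ = (E σ).comp (((g.eps σ).comp (circleFlip l1)).comp (E (Y.finv σ))) := rfl
      _ = (E σ).comp ((circleFlip l2).comp ((g.eps (Y.finv σ)).comp (E (Y.finv σ)))) := by
          rw [← e]; rfl
      _ = _ := by rw [hE1]; rfl
  have hCeps : ∀ σ τ (h : g.mapF σ = τ), HEq ((g.eps σ).comp (C σ τ h))
      (GraphHom.id (circle (X.len τ))) := by
    intro σ τ h
    subst h
    exact heq_of_eq (hE1 σ)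
  have hFinv : ∀ τ, F (X.finv τ) = Y.finv (F τ) := fun τ => by
    apply hg.bijF.1
    rw [hFg, g.mapF_finv, hFg]
  let H : Hom X Y :=
    { toGraphHom := G
      mapF := F
      eps := fun τ => C (F τ) τ (hFg τ)
      eps_iso := fun τ => hCiso _ _ _
      att_comm := fun τ => hCatt _ _ _
      mapF_finv := hFinv
      eps_finv := fun τ => hCinv _ _ _ _ _ _ (hFinv τ) _ _ }
  refine ⟨H, ⟨?_, ?_, F.bijective⟩, ?_⟩
  · exact (Equiv.ofBijective _ hg.bijV).symm.bijective
  · exact (Equiv.ofBijective _ hg.bijE).symm.bijective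
  · exact Hom.ext_heq hgG (funext hFg) fun τ => hCeps _ _ _

theorem Hom.IsIso.comp {g : Hom X Z} {f : Hom Y X} (hg : g.IsIso) (hf : f.IsIso) :
    (g.comp f).IsIso := ⟨hg.bijV.comp hf.bijV, hg.bijE.comp hf.bijE, hg.bijF.comp hf.bijF⟩

theorem Hom.isIso_id (X : TwoComplex.{u}) : (Hom.id X).IsIso :=
  ⟨Function.bijective_id, Function.bijective_id, Function.bijective_id⟩

theorem Hom.IsCovering.comp {g : Hom X Z} {f : Hom Y X} (hg : g.IsCovering) (hf : f.IsCovering) :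
    (g.comp f).IsCovering :=
  ⟨fun y => (hg.edges (f.mapV y)).comp (hf.edges y),
    fun y => (hg.faces (f.mapV y)).comp (hf.faces y)⟩

theorem Hom.IsIso.isCovering {f : Hom Y X} (hf : f.IsIso) : f.IsCovering where
  edges := fun y => by
    refine ⟨fun a b h => Subtype.ext (hf.bijE.1 (congrArg Subtype.val h)), ?_⟩
    rintro ⟨e, he⟩
    obtain ⟨e, rfl⟩ := hf.bijE.2 e
    exact ⟨⟨e, hf.bijV.1 (by rw [← f.src_map, he])⟩, rfl⟩
  faces := fun y => by
    constructor
    · rintro ⟨⟨σ, x⟩, hx⟩ ⟨⟨σ', x'⟩, hx'⟩ h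
      have h1 := congrArg Subtype.val h
      have h2 : f.mapF σ = f.mapF σ' := congrArg Sigma.fst h1
      obtain rfl := hf.bijF.1 h2
      have h3 := eq_of_heq (Sigma.mk.inj h1).2
      obtain rfl := (f.eps_iso σ).bijV.1 h3
      rfl
    · rintro ⟨⟨τ, x⟩, hx⟩
      obtain ⟨σ, rfl⟩ := hf.bijF.2 τ
      obtain ⟨x, rfl⟩ := (f.eps_iso σ).bijV.2 x
      refine ⟨⟨⟨σ, x⟩, hf.bijV.1 ?_⟩, rfl⟩
      rw [← f.cornerMap_at]
      exact hx

/-- A self-map over a covering that fixes a vertex fixes every cell. -/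
theorem Hom.IsCovering.eq_id {f : Hom Y X} (hf : f.IsCovering) (hY : Y.Connected) {k : Hom Y Y}
    (hk : f.comp k = f) {y : Y.V} (hy : k.mapV y = y) :
    (∀ a, k.mapV a = a) ∧ (∀ e, k.mapE e = e) ∧ ∀ σ, k.mapF σ = σ := by
  have hE0 : ∀ e, f.mapE (k.mapE e) = f.mapE e := fun e =>
    congrArg (fun φ : Hom Y X => φ.mapE e) hk
  have hC0 : ∀ c, f.cornerMap (k.cornerMap c) = f.cornerMap c := fun c =>
    congrArg (fun φ : Hom Y X => φ.cornerMap c) hk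
  have hE1 : ∀ e, k.mapV (Y.src e) = Y.src e → k.mapE e = e := by
    intro e he
    have h1 : Y.src (k.mapE e) = Y.src e := by rw [k.src_map, he]
    exact congrArg Subtype.val ((hf.edges (Y.src e)).1
      (a₁ := ⟨k.mapE e, h1⟩) (a₂ := ⟨e, rfl⟩) (Subtype.ext (hE0 e)))
  have hP : ∀ (l : List Y.E) (a b : Y.V), IsPath Y.toSGraph a l b → k.mapV a = a →
      k.mapV b = b := by
    intro l
    induction l with
    | nil => intro a b h; cases h; exact fun h => h
    | cons e l ih =>
      intro a b h ha
      refine ih _ _ h.2 ?_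
      rw [← k.tgt_map, hE1 e (by rw [h.1, ha])]
  have hV : ∀ a, k.mapV a = a := fun a => by
    obtain ⟨p⟩ := hY y a
    exact hP _ _ _ p.isPath hy
  refine ⟨hV, fun e => hE1 e (hV _), fun σ => ?_⟩
  let c : Y.Corner := ⟨σ, (0 : ZMod (max (Y.len σ) 1))⟩
  have h1 : (k.cornerMap c).at = c.at := by rw [k.cornerMap_at, hV]
  have h2 := congrArg Subtype.val ((hf.faces c.at).1
      (a₁ := ⟨k.cornerMap c, h1⟩) (a₂ := ⟨c, rfl⟩) (Subtype.ext (hC0 c)))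
  exact congrArg Sigma.fst h2

namespace PointedCover

variable {v : X.V}

theorem Equivalent.refl (c : PointedCover X v) : c.Equivalent c :=
  ⟨Hom.id _, Hom.isIso_id _, rfl, rfl⟩

theorem Equivalent.symm {c d : PointedCover X v} (h : c.Equivalent d) : d.Equivalent c := by
  obtain ⟨g, hg, hb, hp⟩ := h
  obtain ⟨k, hk, hgk⟩ := hg.exists_inverse
  refine ⟨k, hk, hg.bijV.1 ?_, ?_⟩
  · rw [hb]
    exact congrArg (fun φ : Hom d.cover d.cover => φ.mapV d.base) hgk
  · calc c.proj.comp k = d.proj.comp (g.comp k) := by rw [← hp]; rfl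
      _ = d.proj := by rw [hgk]; rfl

theorem Equivalent.trans {c d e : PointedCover X v} (h : c.Equivalent d) (k : d.Equivalent e) :
    c.Equivalent e := by
  obtain ⟨g, hg, hb, hp⟩ := h
  obtain ⟨g', hg', hb', hp'⟩ := k
  refine ⟨g'.comp g, hg'.comp hg, (congrArg g'.mapV hb).trans hb', ?_⟩
  rw [← hp, ← hp']
  rfl

theorem Equivalent.le {c d : PointedCover X v} (h : c.Equivalent d) : d.Le c := by
  obtain ⟨g, hg, hb, hp⟩ := h
  exact ⟨g, hg.isCovering, hb, hp⟩

theorem Le.trans {c d e : PointedCover X v} (h : c.Le d) (k : d.Le e) : c.Le e := by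
  obtain ⟨g, hg, hb, hp⟩ := h
  obtain ⟨g', hg', hb', hp'⟩ := k
  refine ⟨g.comp g', hg.comp hg', (congrArg g.mapV hb').trans hb, ?_⟩
  rw [← hp', ← hp]
  rfl

theorem Le.antisymm {c d : PointedCover X v} (h : c.Le d) (k : d.Le c) : c.Equivalent d := by
  obtain ⟨g, hg, hb, hp⟩ := h
  obtain ⟨g', hg', hb', hp'⟩ := k
  have h1 : c.proj.comp (g.comp g') = c.proj := by
    calc c.proj.comp (g.comp g') = (c.proj.comp g).comp g' := rfl
      _ = c.proj := by rw [hp, hp']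
  have h2 : d.proj.comp (g'.comp g) = d.proj := by
    calc d.proj.comp (g'.comp g) = (d.proj.comp g').comp g := rfl
      _ = d.proj := by rw [hp', hp]
  obtain ⟨v1, e1, f1⟩ := c.isCovering.eq_id c.connected h1 ((congrArg g.mapV hb').trans hb)
  obtain ⟨v2, e2, f2⟩ := d.isCovering.eq_id d.connected h2 ((congrArg g'.mapV hb).trans hb')
  exact ⟨g', ⟨Function.bijective_iff_has_inverse.2 ⟨_, v1, v2⟩,
    Function.bijective_iff_has_inverse.2 ⟨_, e1, e2⟩,
    Function.bijective_iff_has_inverse.2 ⟨_, f1, f2⟩⟩, hb', hp'⟩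

end PointedCover

/-- Equivalence of pointed coverings. -/
def coverSetoid (X : TwoComplex.{u}) (v : X.V) : Setoid (PointedCover X v) :=
  ⟨PointedCover.Equivalent, ⟨PointedCover.Equivalent.refl, PointedCover.Equivalent.symm,
    PointedCover.Equivalent.trans⟩⟩

/-- The set `L(X_v)` of equivalence classes of pointed connected coverings of `X_v`. -/
def CoverClass (X : TwoComplex.{u}) (v : X.V) : Type (u + 1) := Quotient (coverSetoid X v)

/-- The equivalence class of a pointed covering. -/
def PointedCover.cls {v : X.V} (c : PointedCover X v) : CoverClass X v :=
  Quotient.mk (coverSetoid X v) c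

/-- The set of equivalence classes of coverings, ordered by: the class of `c` is at most the class
of `d` if `d` covers `c`. -/
instance (v : X.V) : PartialOrder (CoverClass X v) where
  le := Quotient.lift₂ PointedCover.Le (fun _ _ _ _ h k => propext
    ⟨fun l => (h.le.trans l).trans k.symm.le, fun l => (h.symm.le.trans l).trans k.le⟩)
  le_refl := by
    rintro ⟨c⟩
    exact (PointedCover.Equivalent.refl c).le
  le_trans := by
    rintro ⟨c⟩ ⟨d⟩ ⟨e⟩ h k
    exact PointedCover.Le.trans h k
  le_antisymm := by
    rintro ⟨c⟩ ⟨d⟩ h k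
    exact Quotient.sound (PointedCover.Le.antisymm h k)

theorem PointedCover.cls_le {v : X.V} {c d : PointedCover X v} : c.cls ≤ d.cls ↔ c.Le d := Iff.rfl

theorem PointedCover.cls_eq {v : X.V} {c d : PointedCover X v} :
    c.cls = d.cls ↔ c.Equivalent d :=
  ⟨fun h => Quotient.exact h, fun h => Quotient.sound h⟩

/-! ## The bottom-up (Schreier coset) cover `X↑H` -/

namespace BottomUp

variable {v : X.V}

/-- Paths in `X` that start at `v`. -/
abbrev PathFrom (X : TwoComplex.{u}) (v : X.V) : Type u := Σ b : X.V, GPath X.toSGraph v b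

/-- `p ~ q` if `p q⁻¹` is a closed path at `v` that represents an element of `H`. -/
def Rel (H : Subgroup (Pi1 X v)) (p q : PathFrom X v) : Prop :=
  ∃ l : GPath X.toSGraph v v, l.edges = p.2.edges ++ revEdges X.toSGraph q.2.edges ∧ Pi1.mk l ∈ H

theorem rel_iff (H : Subgroup (Pi1 X v)) {b : X.V} (p q : GPath X.toSGraph v b) :
    Rel H ⟨b, p⟩ ⟨b, q⟩ ↔ Pi1.mk (p.trans q.symm) ∈ H := by
  constructor
  · rintro ⟨l, hl, h⟩
    have : l = p.trans q.symm := GPath.ext hl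
    rwa [← this]
  · exact fun h => ⟨p.trans q.symm, rfl, h⟩

theorem rel_end {H : Subgroup (Pi1 X v)} {p q : PathFrom X v} (h : Rel H p q) : p.1 = q.1 := by
  obtain ⟨b, p⟩ := p
  obtain ⟨c, q⟩ := q
  obtain ⟨l, hl, -⟩ := h
  have h1 := l.isPath
  rw [hl] at h1
  obtain ⟨d, h2, h3⟩ := isPath_split h1
  have h4 : b = d := isPath_end_unique p.isPath h2
  have h5 := isPath_rev h3
  rw [revEdges_revEdges] at h5
  have h6 : d = c := isPath_end_unique h5 q.isPath
  exact h4.trans h6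

theorem homotopic_cancel {a b c d : X.V} (p : GPath X.toSGraph a b) (q : GPath X.toSGraph c b)
    (r : GPath X.toSGraph b d) :
    Homotopic ((p.trans q.symm).trans (q.trans r)) (p.trans r) := by
  have h1 : (p.trans q.symm).trans (q.trans r) = (p.trans (q.symm.trans q)).trans r :=
    GPath.ext (by simp [GPath.trans])
  have h2 : (p.trans (GPath.nil b)).trans r = p.trans r :=
    GPath.ext (by simp [GPath.trans, GPath.nil])
  rw [h1, ← h2]
  exact Homotopic.trans_right _ (Homotopic.trans_left _ (homotopic_symm_trans q))

theorem rel_equivalence (H : Subgroup (Pi1 X v)) : Equivalence (Rel H) where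
  refl := by
    rintro ⟨b, p⟩
    rw [rel_iff, Pi1.mk_eq.2 (homotopic_trans_symm p)]
    exact H.one_mem
  symm := by
    rintro ⟨b, p⟩ ⟨c, q⟩ h
    obtain rfl : b = c := rel_end h
    rw [rel_iff] at h ⊢
    have := H.inv_mem h
    rw [Pi1.mk_inv] at this
    convert this using 2
    exact GPath.ext (by simp [GPath.trans, GPath.symm, revEdges_append, revEdges_revEdges])
  trans := by
    rintro ⟨b, p⟩ ⟨c, q⟩ ⟨d, r⟩ h k
    obtain rfl : b = c := rel_end h
    obtain rfl : b = d := rel_end k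
    rw [rel_iff] at h k ⊢
    have := H.mul_mem h k
    rw [Pi1.mk_mul] at this
    rwa [← Pi1.mk_eq.2 (homotopic_cancel p q r.symm)]

def setoid (H : Subgroup (Pi1 X v)) : Setoid (PathFrom X v) := ⟨Rel H, rel_equivalence H⟩

/-- The vertices of `X↑H`: the classes `u_γ` of paths `γ` starting at `v`. -/
def Vertex (H : Subgroup (Pi1 X v)) : Type u := Quotient (setoid H)

variable {H : Subgroup (Pi1 X v)}

/-- The vertex `u_γ`. -/
def Vertex.mk (H : Subgroup (Pi1 X v)) (p : PathFrom X v) : Vertex H := Quotient.mk (setoid H) p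

/-- The vertex of `X` covered by `u_γ`, that is, the terminal vertex of `γ`. -/
def endV (a : Vertex H) : X.V := Quotient.lift (s := setoid H) Sigma.fst (fun _ _ h => rel_end h) a

open Classical in
/-- Extension of the path `p` by the edges in `l` (if this is a path; otherwise `p` itself). -/
noncomputable def extend (l : List X.E) (p : PathFrom X v) : PathFrom X v :=
  if h : ∃ c, IsPath X.toSGraph p.1 l c then ⟨h.choose, p.2.trans ⟨l, h.choose_spec⟩⟩ else p

theorem pathFrom_ext {p q : PathFrom X v} (h : p.1 = q.1) (k : p.2.edges = q.2.edges) : p = q := by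
  obtain ⟨b, p⟩ := p
  obtain ⟨c, q⟩ := q
  dsimp only at h
  subst h
  exact congrArg (Sigma.mk b) (GPath.ext k)

theorem extend_eq {l : List X.E} {b c : X.V} (p : GPath X.toSGraph v b)
    (h : IsPath X.toSGraph b l c) : extend l ⟨b, p⟩ = ⟨c, p.trans ⟨l, h⟩⟩ := by
  have h' : ∃ c, IsPath X.toSGraph b l c := ⟨c, h⟩
  have e : extend l ⟨b, p⟩ = ⟨h'.choose, p.trans ⟨l, h'.choose_spec⟩⟩ := dif_pos h'
  rw [e]
  exact pathFrom_ext (isPath_end_unique h'.choose_spec h) rfl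

theorem rel_trans {b c : X.V} {p q : GPath X.toSGraph v b} (h : Rel H ⟨b, p⟩ ⟨b, q⟩)
    {r r' : GPath X.toSGraph b c} (k : Homotopic r r') :
    Rel H ⟨c, p.trans r⟩ ⟨c, q.trans r'⟩ := by
  rw [rel_iff] at h ⊢
  rw [← Pi1.mk_eq.2 (show Homotopic ((p.trans r).trans (q.trans r').symm) (p.trans q.symm) from ?_)]
    at h
  · exact h
  · have e1 : (p.trans r).trans (q.trans r').symm = p.trans ((r.trans r'.symm).trans q.symm) :=
      GPath.ext (by simp [GPath.trans, GPath.symm, revEdges_append])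
    have e2 : p.trans ((GPath.nil b).trans q.symm) = p.trans q.symm :=
      GPath.ext (by simp [GPath.trans, GPath.nil])
    rw [e1, ← e2]
    exact Homotopic.trans_left _ (Homotopic.trans_right _
      ((Homotopic.trans_right _ k).trans (homotopic_trans_symm r')))

/-- `walk l u_γ = u_{γ l}`, whenever the edges in `l` form a path starting at the end of `γ`. -/
noncomputable def walk (l : List X.E) : Vertex H → Vertex H :=
  Quotient.map (sa := setoid H) (sb := setoid H) (extend l) (by
    rintro ⟨b, p⟩ ⟨b', q⟩ h
    obtain rfl : b = b' := rel_end h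
    by_cases hl : ∃ c, IsPath X.toSGraph b l c
    · obtain ⟨c, hc⟩ := hl
      rw [extend_eq p hc, extend_eq q hc]
      exact rel_trans h (Homotopic.refl _)
    · have e1 : extend l ⟨b, p⟩ = ⟨b, p⟩ := dif_neg hl
      have e2 : extend l ⟨b, q⟩ = ⟨b, q⟩ := dif_neg hl
      rw [e1, e2]
      exact h)

theorem walk_mk {l : List X.E} {b c : X.V} (p : GPath X.toSGraph v b)
    (h : IsPath X.toSGraph b l c) :
    walk l (Vertex.mk H ⟨b, p⟩) = Vertex.mk H ⟨c, p.trans ⟨l, h⟩⟩ :=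
  congrArg (Vertex.mk H) (extend_eq p h)

theorem exists_rep (a : Vertex H) : ∃ p : GPath X.toSGraph v (endV a), a = Vertex.mk H ⟨_, p⟩ := by
  obtain ⟨⟨b, p⟩⟩ := a
  exact ⟨p, rfl⟩

theorem endV_walk {l : List X.E} {a : Vertex H} {c : X.V} (h : IsPath X.toSGraph (endV a) l c) :
    endV (walk l a) = c := by
  obtain ⟨⟨b, p⟩⟩ := a
  exact congrArg endV (walk_mk (H := H) p h)

theorem walk_nil (a : Vertex H) : walk [] a = a := by
  obtain ⟨⟨b, p⟩⟩ := a
  refine (walk_mk (H := H) p (l := []) (c := b) (Eq.refl b)).trans (congrArg (Vertex.mk H) ?_)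
  exact pathFrom_ext rfl (List.append_nil _)

theorem walk_append {l m : List X.E} {a : Vertex H} {c d : X.V}
    (h : IsPath X.toSGraph (endV a) l c) (k : IsPath X.toSGraph c m d) :
    walk (l ++ m) a = walk m (walk l a) := by
  obtain ⟨⟨b, p⟩⟩ := a
  refine (walk_mk (H := H) p (isPath_append h k)).trans ?_
  refine Eq.trans ?_ (congrArg (walk m) (walk_mk (H := H) p h)).symm
  rw [walk_mk _ k]
  exact congrArg (Vertex.mk H) (pathFrom_ext rfl (List.append_assoc _ _ _).symm)

theorem walk_homotopic {a : Vertex H} {b c : X.V} (hb : endV a = b) {r r' : GPath X.toSGraph b c}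
    (h : Homotopic r r') : walk r.edges a = walk r'.edges a := by
  subst hb
  obtain ⟨⟨b, p⟩⟩ := a
  refine (walk_mk (H := H) p r.isPath).trans ((walk_mk (H := H) p r'.isPath).trans ?_).symm
  exact Quotient.sound (s := setoid H) (rel_trans ((rel_equivalence H).refl _) h.symm)

theorem walk_rev {l : List X.E} {a : Vertex H} {c : X.V} (h : IsPath X.toSGraph (endV a) l c) :
    walk (revEdges X.toSGraph l) (walk l a) = a := by
  rw [← walk_append h (isPath_rev h)]
  exact (walk_homotopic rfl (homotopic_trans_symm ⟨l, h⟩)).trans (walk_nil a)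

theorem isPath_single (e : X.E) : IsPath X.toSGraph (X.src e) [e] (X.tgt e) := ⟨rfl, rfl⟩

/-- The 1-skeleton of `X↑H`. The edges are the pairs `(u_γ, e)` with `e` an edge of `X` starting at
the end of `γ`; such an edge runs from `u_γ` to `u_{γ e}`, which is the only vertex `u_μ` for which
`γ e μ⁻¹` represents an element of `H`. -/
noncomputable def graph (H : Subgroup (Pi1 X v)) : SGraph.{u} where
  V := Vertex H
  E := {p : Vertex H × X.E // endV p.1 = X.src p.2}
  src := fun p => p.1.1
  inv := fun p => ⟨(walk [p.1.2] p.1.1, X.inv p.1.2), by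
    refine endV_walk ?_
    rw [p.2]
    exact isPath_single _⟩
  inv_inv := by
    rintro ⟨⟨a, e⟩, h⟩
    have h1 : IsPath X.toSGraph (endV a) [e] (X.tgt e) := by rw [h]; exact isPath_single e
    exact Subtype.ext (Prod.ext (walk_rev h1) (X.inv_inv e))
  inv_ne := by
    rintro ⟨⟨a, e⟩, h⟩ k
    exact X.inv_ne e (congrArg (fun p => p.1.2) k)

/-- The projection of the 1-skeleton: `u_γ` goes to the end of `γ` and the edge arising from `e`
to `e`. -/
noncomputable def graphProj (H : Subgroup (Pi1 X v)) : GraphHom (graph H) X.toSGraph where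
  mapV := endV
  mapE := fun p => p.1.2
  src_map := fun p => p.2.symm
  inv_map := fun _ => rfl

/-- The vertex `0` of the boundary sphere of a face, as a vertex of `X`. -/
def faceBase (σ : X.F) : X.V := (X.att σ).mapV (0 : ZMod (max (X.len σ) 1))

theorem edge_isPath (σ : X.F) (x : ZMod (max (X.len σ) 1)) (h : X.len σ ≠ 0) :
    IsPath X.toSGraph ((X.att σ).mapV x) [(X.att σ).mapE (⟨x, true, h⟩ : CircleEdge (X.len σ))]
      ((X.att σ).mapV (x + 1 : ZMod (max (X.len σ) 1))) :=
  ⟨(X.att σ).src_map _, (X.att σ).tgt_map _⟩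

theorem take_succ_boundary (σ : X.F) (k : ℕ) (hk : k < X.len σ) :
    (X.boundaryPath σ 0).take (k + 1) = (X.boundaryPath σ 0).take k ++
      [(X.att σ).mapE (⟨(k : ZMod (max (X.len σ) 1)), true, Nat.ne_zero_of_lt hk⟩ :
        CircleEdge (X.len σ))] := by
  rw [List.take_succ_eq_append_getElem (by simpa [boundaryPath] using hk)]
  simp [boundaryPath]

theorem take_isPath (σ : X.F) (k : ℕ) (hk : k ≤ X.len σ) :
    IsPath X.toSGraph (faceBase σ) ((X.boundaryPath σ 0).take k)
      ((X.att σ).mapV (k : ZMod (max (X.len σ) 1))) := by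
  induction k with
  | zero => exact congrArg (X.att σ).mapV (Nat.cast_zero (R := ZMod (max (X.len σ) 1))).symm
  | succ k ih =>
    rw [take_succ_boundary σ k hk]
    have := isPath_append (ih (by omega)) (edge_isPath σ k (Nat.ne_zero_of_lt hk))
    rwa [← Nat.cast_succ] at this

theorem cast_len (n : ℕ) : ((n : ℕ) : ZMod (max n 1)) = 0 := by
  rcases Nat.eq_zero_or_pos n with h | h
  · subst h; simp
  · have : ((max n 1 : ℕ) : ZMod (max n 1)) = 0 := ZMod.natCast_self _
    rwa [max_eq_left (show 1 ≤ n from h)] at this ⊢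

theorem boundary_isPath (σ : X.F) :
    IsPath X.toSGraph (faceBase σ) (X.boundaryPath σ 0) (faceBase σ) := by
  have h := take_isPath σ (X.len σ) le_rfl
  rw [cast_len, List.take_of_length_le (by simp [boundaryPath])] at h
  exact h

theorem walk_boundary (σ : X.F) {a : Vertex H} (ha : endV a = faceBase σ) :
    walk (X.boundaryPath σ 0) a = a := by
  refine (walk_homotopic ha (r := ⟨_, boundary_isPath σ⟩) (r' := GPath.nil _) ?_).trans (walk_nil a)
  exact Homotopic.symm (Relation.EqvGen.rel _ _ ⟨[], X.boundaryPath σ 0, [], rfl, by simp,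
    Or.inr ⟨σ, 0, rfl⟩⟩)

/-- The lift to `a` of the boundary path of `σ`, on vertices. -/
noncomputable def liftV (σ : X.F) (a : Vertex H) (x : ZMod (max (X.len σ) 1)) : Vertex H :=
  walk ((X.boundaryPath σ 0).take x.val) a

theorem val_le (n : ℕ) (x : ZMod (max n 1)) : x.val ≤ n := by
  have : NeZero (max n 1) := ⟨by omega⟩
  have := ZMod.val_lt x
  omega

theorem liftV_isPath (σ : X.F) {a : Vertex H} (ha : endV a = faceBase σ)
    (x : ZMod (max (X.len σ) 1)) :
    IsPath X.toSGraph (endV a) ((X.boundaryPath σ 0).take x.val) ((X.att σ).mapV x) := by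
  have : NeZero (max (X.len σ) 1) := ⟨by omega⟩
  have h := take_isPath σ x.val (val_le _ x)
  rw [ZMod.natCast_zmod_val] at h
  rwa [ha]

theorem endV_liftV (σ : X.F) {a : Vertex H} (ha : endV a = faceBase σ)
    (x : ZMod (max (X.len σ) 1)) : endV (liftV σ a x) = (X.att σ).mapV x :=
  endV_walk (liftV_isPath σ ha x)

theorem liftV_zero (σ : X.F) (a : Vertex H) : liftV σ a 0 = a := by
  unfold liftV
  rw [ZMod.val_zero]
  exact walk_nil a

theorem liftV_add_one (σ : X.F) {a : Vertex H} (ha : endV a = faceBase σ)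
    (x : ZMod (max (X.len σ) 1)) (h : X.len σ ≠ 0) :
    liftV σ a (x + 1) =
      walk [(X.att σ).mapE (⟨x, true, h⟩ : CircleEdge (X.len σ))] (liftV σ a x) := by
  have : NeZero (max (X.len σ) 1) := ⟨by omega⟩
  have hlt : x.val < X.len σ := by
    have := ZMod.val_lt x
    omega
  have h1 : walk ((X.boundaryPath σ 0).take (x.val + 1)) a =
      walk [(X.att σ).mapE (⟨x, true, h⟩ : CircleEdge (X.len σ))] (liftV σ a x) := by
    rw [take_succ_boundary σ x.val hlt]
    have hx : ((x.val : ℕ) : ZMod (max (X.len σ) 1)) = x := ZMod.natCast_zmod_val x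
    simp only [hx]
    exact walk_append (liftV_isPath σ ha x) (edge_isPath σ x h)
  rw [← h1]
  have hx : x + 1 = ((x.val + 1 : ℕ) : ZMod (max (X.len σ) 1)) := by
    rw [Nat.cast_succ, ZMod.natCast_zmod_val]
  by_cases hc : x.val + 1 = X.len σ
  · rw [hx, hc, cast_len, liftV_zero, List.take_of_length_le (by simp [boundaryPath]),
      walk_boundary σ ha]
  · unfold liftV
    rw [hx, ZMod.val_natCast_of_lt (by omega)]

/-- The lift to `a` of the attaching map of `σ`. -/
noncomputable def liftAtt (σ : X.F) (a : Vertex H) (ha : endV a = faceBase σ) :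
    GraphHom (circle (X.len σ)) (graph H) where
  mapV := liftV σ a
  mapE := fun c => ⟨(liftV σ a ((circle (X.len σ)).src c), (X.att σ).mapE c),
    (endV_liftV σ ha _).trans ((X.att σ).src_map c).symm⟩
  src_map := fun _ => rfl
  inv_map := by
    have key : ∀ c, liftV σ a ((circle (X.len σ)).tgt c) =
        walk [(X.att σ).mapE c] (liftV σ a ((circle (X.len σ)).src c)) := by
      rintro ⟨x, b, h⟩
      cases b
      · have h1 := liftV_add_one σ ha x h
        have h2 : IsPath X.toSGraph (endV (liftV σ a x)) _ _ :=
          (endV_liftV σ ha x).symm ▸ edge_isPath σ x h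
        have h3 := walk_rev h2
        rw [← h1] at h3
        have h4 : (X.att σ).mapE (⟨x, false, h⟩ : CircleEdge (X.len σ)) =
            X.inv ((X.att σ).mapE (⟨x, true, h⟩ : CircleEdge (X.len σ))) :=
          (X.att σ).inv_map (⟨x, true, h⟩ : CircleEdge (X.len σ))
        rw [h4]
        simpa [circle, SGraph.tgt, revEdges] using h3.symm
      · simpa [circle, SGraph.tgt] using liftV_add_one σ ha x h
    intro c
    exact Subtype.ext (Prod.ext (key c) ((X.att σ).inv_map c))

theorem proj_liftAtt (σ : X.F) (a : Vertex H) (ha : endV a = faceBase σ) :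
    (graphProj H).comp (liftAtt σ a ha) = X.att σ :=
  GraphHom.ext (funext fun x => endV_liftV σ ha x) rfl

theorem circleHom_ext {n : ℕ} {φ ψ : GraphHom (circle n) (graph H)}
    (h : (graphProj H).comp φ = (graphProj H).comp ψ)
    (h0 : φ.mapV (0 : ZMod (max n 1)) = ψ.mapV (0 : ZMod (max n 1))) : φ = ψ := by
  have hE : ∀ c, φ.mapV ((circle n).src c) = ψ.mapV ((circle n).src c) → φ.mapE c = ψ.mapE c := by
    intro c hc
    rw [← φ.src_map, ← ψ.src_map] at hc
    exact Subtype.ext (Prod.ext hc (congrArg (fun θ => GraphHom.mapE θ c) h))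
  have : NeZero (max n 1) := ⟨by omega⟩
  have hk : ∀ k : ℕ, φ.mapV (k : ZMod (max n 1)) = ψ.mapV (k : ZMod (max n 1)) := by
    intro k
    by_cases hn : n = 0
    · subst hn
      have : (k : ZMod (max 0 1)) = 0 := Subsingleton.elim (α := ZMod 1) _ _
      rw [this]
      exact h0
    · induction k with
      | zero => simpa using h0
      | succ k ih =>
        have e := hE (⟨(k : ZMod (max n 1)), true, hn⟩ : CircleEdge n) ih
        have h1 := φ.tgt_map (⟨(k : ZMod (max n 1)), true, hn⟩ : CircleEdge n)
        have h2 := ψ.tgt_map (⟨(k : ZMod (max n 1)), true, hn⟩ : CircleEdge n)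
        rw [e] at h1
        have h3 := h1.symm.trans h2
        rw [Nat.cast_succ]
        exact h3
  have hV : ∀ x : ZMod (max n 1), φ.mapV x = ψ.mapV x := fun x => by
    have := hk x.val
    rwa [ZMod.natCast_zmod_val] at this
  exact GraphHom.ext (funext hV) (funext fun c => hE c (hV _))

theorem circleFlip_zero {m n : ℕ} (h : m = n) :
    (circleFlip h).mapV (0 : ZMod (max m 1)) = (0 : ZMod (max n 1)) := by
  subst h
  exact neg_zero (G := ZMod (max m 1))

theorem faceBase_finv (σ : X.F) : faceBase (X.finv σ) = faceBase σ := by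
  unfold faceBase
  rw [X.att_finv]
  exact congrArg (X.att σ).mapV (circleFlip_zero _)

/-- The 2-complex `X↑H`: for every face `σ` of `X`, with the boundary path of `σ` taken to start at
the vertex `0` of its boundary sphere, and for every vertex `a` of `X↑H` that covers the start
vertex of this path, there is a face `(a, σ)`, sewn in along the lift of the path to `a`. -/
noncomputable def complex (H : Subgroup (Pi1 X v)) : TwoComplex.{u} where
  toSGraph := graph H
  F := {p : Vertex H × X.F // endV p.1 = faceBase p.2}
  len := fun p => X.len p.1.2
  att := fun p => liftAtt p.1.2 p.1.1 p.2
  finv := fun p => ⟨(p.1.1, X.finv p.1.2), p.2.trans (faceBase_finv _).symm⟩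
  finv_finv := fun p => Subtype.ext (Prod.ext rfl (X.finv_finv _))
  finv_ne := fun p h => X.finv_ne p.1.2 (congrArg (fun q => q.1.2) h)
  len_finv := fun p => X.len_finv p.1.2
  att_finv := by
    rintro ⟨⟨a, σ⟩, ha⟩
    refine circleHom_ext ?_ ?_
    · exact (proj_liftAtt _ a _).trans ((X.att_finv σ).trans
        (congrArg (fun φ => φ.comp (circleFlip (X.len_finv σ))) (proj_liftAtt σ a ha).symm))
    refine (liftV_zero _ a).trans (Eq.trans ?_
      (congrArg (liftV σ a) (circleFlip_zero (X.len_finv σ))).symm)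
    exact (liftV_zero _ a).symm

/-- The projection `X↑H → X`, sending the face `(a, σ)` to `σ`. -/
noncomputable def proj (H : Subgroup (Pi1 X v)) : Hom (complex H) X where
  toGraphHom := graphProj H
  mapF := fun p => p.1.2
  eps := fun _ => GraphHom.id _
  eps_iso := fun _ => Hom.circle_id_iso _
  att_comm := fun p => proj_liftAtt p.1.2 p.1.1 p.2
  mapF_finv := fun _ => rfl
  eps_finv := fun _ => rfl

theorem proj_isCovering (H : Subgroup (Pi1 X v)) : (proj H).IsCovering where
  edges := by
    intro a
    constructor
    · rintro ⟨⟨⟨b, e⟩, h⟩, rfl⟩ ⟨⟨⟨b', e'⟩, h'⟩, hb⟩ k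
      obtain rfl : b' = b := hb
      obtain rfl : e = e' := congrArg Subtype.val k
      rfl
    · rintro ⟨e, he⟩
      exact ⟨⟨⟨(a, e), he.symm⟩, rfl⟩, rfl⟩
  faces := by
    intro a
    constructor
    · rintro ⟨⟨⟨⟨b, σ⟩, hb⟩, x⟩, hx⟩ ⟨⟨⟨⟨b', σ'⟩, hb'⟩, x'⟩, hx'⟩ k
      have k1 := congrArg Subtype.val k
      obtain rfl : σ = σ' := congrArg Sigma.fst k1
      obtain rfl : x = x' := eq_of_heq (Sigma.mk.inj k1).2
      have e1 := walk_rev (liftV_isPath σ hb x)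
      have e2 := walk_rev (liftV_isPath σ hb' x)
      have e3 : walk ((X.boundaryPath σ 0).take (ZMod.val (n := max (X.len σ) 1) x)) b =
        walk ((X.boundaryPath σ 0).take (ZMod.val (n := max (X.len σ) 1) x)) b' := hx.trans hx'.symm
      rw [e3] at e1
      obtain rfl : b = b' := e1.symm.trans e2
      rfl
    · rintro ⟨⟨σ, x⟩, hx⟩
      have hx' : (X.att σ).mapV x = endV a := hx
      have : NeZero (max (X.len σ) 1) := ⟨by omega⟩
      have h1 := take_isPath σ (ZMod.val (n := max (X.len σ) 1) x) (val_le _ x)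
      have hv : ((ZMod.val (n := max (X.len σ) 1) x : ℕ) : ZMod (max (X.len σ) 1)) = x :=
        ZMod.natCast_zmod_val (n := max (X.len σ) 1) x
      rw [hv, hx'] at h1
      have h2 := isPath_rev h1
      have h3 := walk_rev h2
      rw [revEdges_revEdges] at h3
      exact ⟨⟨⟨⟨(walk (revEdges X.toSGraph _) a, σ), endV_walk h2⟩, x⟩, h3⟩, rfl⟩

theorem exists_lift (l : List X.E) (a : Vertex H) (c : X.V)
    (h : IsPath X.toSGraph (endV a) l c) : ∃ L, IsPath (graph H) a L (walk l a) := by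
  induction l generalizing a with
  | nil => exact ⟨[], (walk_nil a).symm⟩
  | cons e l ih =>
    have h1 : IsPath X.toSGraph (endV a) [e] (X.tgt e) := ⟨h.1, rfl⟩
    have h2 := h.2
    rw [← endV_walk h1] at h2
    obtain ⟨L, hL⟩ := ih _ h2
    refine ⟨⟨(a, e), h.1.symm⟩ :: L, rfl, ?_⟩
    have h3 := walk_append h1 h.2
    rw [List.singleton_append] at h3
    rw [h3]
    exact hL

/-- The base vertex of `X↑H`, the class of the trivial path. -/
def baseV (H : Subgroup (Pi1 X v)) : Vertex H := Vertex.mk H ⟨v, GPath.nil v⟩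

theorem connected (H : Subgroup (Pi1 X v)) : (complex H).Connected := by
  have h : ∀ a : Vertex H, Nonempty (GPath (graph H) (baseV H) a) := by
    intro a
    obtain ⟨⟨b, p⟩⟩ := a
    obtain ⟨L, hL⟩ := exists_lift p.edges (baseV H) b p.isPath
    rw [show walk p.edges (baseV H) = Vertex.mk H ⟨b, p⟩ from walk_mk (GPath.nil v) p.isPath] at hL
    exact ⟨⟨L, hL⟩⟩
  intro a b
  obtain ⟨p⟩ := h a
  obtain ⟨q⟩ := h b
  exact ⟨p.symm.trans q⟩

end BottomUp

/-- The bottom-up cover `(X↑H)_x → X_v`, pointed at the class `x` of the trivial path. -/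
noncomputable def bottomUp (X : TwoComplex.{u}) (v : X.V) (H : Subgroup (Pi1 X v)) :
    PointedCover X v where
  cover := BottomUp.complex H
  base := BottomUp.baseV H
  proj := BottomUp.proj H
  connected := BottomUp.connected H
  isCovering := BottomUp.proj_isCovering H
  proj_base := rfl

end TwoComplex

end CombTop

/-! Everything rests on unique path lifting. In a covering `f : Y → X` an edge path of `X` has
exactly one lift from each vertex over its start. Spurs lift to spurs, and a boundary path lifts to
the boundary of the face supplied by the bijection on corners, so homotopic paths have lifts with
the same end (`lifts_homotopic`). Hence `f_* π₁(Y, y)` consists of the classes whose lift at `y` is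
closed (`mk_mem_range`), and questions about this subgroup become questions about closed lifts.

The lifting criterion `exists_lift` then constructs maps between coverings: if every path of `X`
with a closed lift in `Z` also has one in `Y`, sending the end of a lift in `Z` to the end of the
lift of the same path in `Y` is well defined, and edges and faces follow by the local bijections.
For two pointed coverings of `X` the hypothesis is an inclusion of subgroups, and the resulting map
is itself a covering by cancellation, so the order on classes is reverse inclusion
(`le_iff_subgroup_le`). By antisymmetry the subgroup determines the class. Every `H` occurs: in
`X↑H` the lift at the base point of a closed path `p` ends at `u_p`, which is the base point exactly
when `p` represents an element of `H` (`bottomUp_subgroup`).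

Moving the base point along a lift of a path `p` conjugates the subgroup. If the subgroup is normal,
closedness of a lift does not depend on the chosen vertex of a fibre, so repointing the covering
gives equivalent pointed coverings, that is, deck transformations. Conversely, a deck transformation
carries closed lifts at the base point to closed lifts at its image, which gives closure under
conjugation. -/

namespace CombTop

namespace TwoComplex

variable {X Y Z : TwoComplex.{u}}

/-! ## Lifting paths along coverings -/

/-- Some path of `Y` from `a` to `b` lies over the list of edges `l`. -/
def Hom.Lifts (f : Hom Y X) (a : Y.V) (l : List X.E) (b : Y.V) : Prop :=
  ∃ L, IsPath Y.toSGraph a L b ∧ L.map f.mapE = l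

namespace Hom

variable {f : Hom Y X}

theorem lifts_nil {a b : Y.V} : f.Lifts a [] b ↔ a = b := by
  constructor
  · rintro ⟨L, hL, h⟩
    obtain rfl := List.map_eq_nil_iff.1 h
    exact hL
  · exact fun h => ⟨[], h, rfl⟩

/-- Lifting is kept as a relation between end points, so that concatenation of paths becomes
composition of relations. This lets later arguments cut a lift at any place. -/
theorem lifts_append {a b : Y.V} {l m : List X.E} :
    f.Lifts a (l ++ m) b ↔ ∃ c, f.Lifts a l c ∧ f.Lifts c m b := by
  constructor
  · rintro ⟨L, hL, h⟩
    obtain ⟨L₁, L₂, rfl, h₁, h₂⟩ := List.map_eq_append_iff.1 h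
    obtain ⟨c, k₁, k₂⟩ := isPath_split hL
    exact ⟨c, ⟨L₁, k₁, h₁⟩, ⟨L₂, k₂, h₂⟩⟩
  · rintro ⟨c, ⟨L₁, k₁, rfl⟩, ⟨L₂, k₂, rfl⟩⟩
    exact ⟨L₁ ++ L₂, isPath_append k₁ k₂, by simp⟩

theorem lifts_edge (f : Hom Y X) (e : Y.E) : f.Lifts (Y.src e) [f.mapE e] (Y.tgt e) :=
  ⟨[e], ⟨rfl, rfl⟩, rfl⟩

theorem Lifts.rev {a b : Y.V} {l : List X.E} (h : f.Lifts a l b) :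
    f.Lifts b (revEdges X.toSGraph l) a := by
  obtain ⟨L, hL, rfl⟩ := h
  exact ⟨revEdges Y.toSGraph L, isPath_rev hL, by simp [revEdges, f.inv_map]⟩

theorem Lifts.isPath {a b : Y.V} {l : List X.E} (h : f.Lifts a l b) :
    IsPath X.toSGraph (f.mapV a) l (f.mapV b) := by
  obtain ⟨L, hL, rfl⟩ := h
  exact isPath_map f.toGraphHom hL

theorem Lifts.comp {g : Hom Z Y} {a b : Z.V} {l : List X.E} (h : (f.comp g).Lifts a l b) :
    f.Lifts (g.mapV a) l (g.mapV b) := by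
  obtain ⟨L, hL, rfl⟩ := h
  exact ⟨L.map g.mapE, isPath_map g.toGraphHom hL, List.map_map⟩

theorem exists_lifts_of_connected (f : Hom Y X) (hY : Y.Connected) (a b : Y.V) :
    ∃ l, f.Lifts a l b := by
  obtain ⟨p⟩ := hY a b
  exact ⟨_, p.edges, p.isPath, rfl⟩

namespace IsCovering

theorem edge_ext (hf : f.IsCovering) {e e' : Y.E} (h : Y.src e = Y.src e')
    (k : f.mapE e = f.mapE e') : e = e' :=
  congrArg Subtype.val ((hf.edges (Y.src e')).1 (a₁ := ⟨e, h⟩) (a₂ := ⟨e', rfl⟩) (Subtype.ext k))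

theorem exists_edge (hf : f.IsCovering) {a : Y.V} {e : X.E} (h : X.src e = f.mapV a) :
    ∃ e', Y.src e' = a ∧ f.mapE e' = e := by
  obtain ⟨⟨e', h'⟩, k⟩ := (hf.edges a).2 ⟨e, h⟩
  exact ⟨e', h', congrArg Subtype.val k⟩

theorem corner_ext (hf : f.IsCovering) {c c' : Y.Corner} (h : c.at = c'.at)
    (k : f.cornerMap c = f.cornerMap c') : c = c' :=
  congrArg Subtype.val ((hf.faces c'.at).1 (a₁ := ⟨c, h⟩) (a₂ := ⟨c', rfl⟩) (Subtype.ext k))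

theorem exists_corner (hf : f.IsCovering) {a : Y.V} {c : X.Corner} (h : c.at = f.mapV a) :
    ∃ c' : Y.Corner, c'.at = a ∧ f.cornerMap c' = c := by
  obtain ⟨⟨c', h'⟩, k⟩ := (hf.faces a).2 ⟨c, h⟩
  exact ⟨c', h', congrArg Subtype.val k⟩

theorem exists_lifts (hf : f.IsCovering) {a : Y.V} {l : List X.E} {x : X.V}
    (h : IsPath X.toSGraph (f.mapV a) l x) : ∃ b, f.Lifts a l b ∧ f.mapV b = x := by
  induction l generalizing a with
  | nil => exact ⟨a, lifts_nil.2 rfl, h⟩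
  | cons e l ih =>
    obtain ⟨e', rfl, rfl⟩ := hf.exists_edge h.1
    have h2 := h.2
    rw [f.tgt_map] at h2
    obtain ⟨b, hb, hx⟩ := ih h2
    exact ⟨b, lifts_append (l := [_]).2 ⟨_, f.lifts_edge e', hb⟩, hx⟩

/-- Injectivity of the local maps on edges forces two lifts from the same vertex to agree edge by
edge. -/
theorem lifts_unique (hf : f.IsCovering) {a b c : Y.V} {l : List X.E} (h : f.Lifts a l b)
    (k : f.Lifts a l c) : b = c := by
  obtain ⟨L, hL, rfl⟩ := h
  obtain ⟨M, hM, h⟩ := k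
  induction L generalizing a M with
  | nil =>
    obtain rfl : M = [] := by simpa using h
    exact hL.symm.trans hM
  | cons e L ih =>
    cases M with
    | nil => simp at h
    | cons e' M =>
      simp only [List.map_cons, List.cons.injEq] at h
      obtain rfl := hf.edge_ext (hM.1.trans hL.1.symm) h.1
      exact ih hL.2 M hM.2 h.2

end IsCovering

end Hom

/-! ### Boundary paths and homotopy invariance of lifts -/

theorem isPath_ofFn {G : SGraph.{u}} (n : ℕ) (s : ℕ → G.V) (e : Fin n → G.E)
    (h₁ : ∀ i, G.src (e i) = s i) (h₂ : ∀ i, G.tgt (e i) = s (i + 1)) :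
    IsPath G (s 0) (List.ofFn e) (s n) := by
  induction n generalizing s with
  | zero => exact Eq.refl (s 0)
  | succ n ih =>
    rw [List.ofFn_succ]
    refine ⟨h₁ 0, ?_⟩
    have h0 : G.tgt (e 0) = s 1 := h₂ 0
    rw [h0]
    exact ih (fun i => s (i + 1)) (fun i => e i.succ)
      (fun i => (h₁ i.succ).trans (by simp)) (fun i => (h₂ i.succ).trans (by simp))

/-- The vertices passed are the images of `x + k`, and the path closes up because the length of the
sphere is `0` in its own cyclic group. Unlike `BottomUp.boundary_isPath`, this covers every starting
point `x`, as a homotopy may insert a boundary path read from any corner. -/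
theorem isPath_boundaryPath (σ : X.F) (x : ZMod (max (X.len σ) 1)) :
    IsPath X.toSGraph ((X.att σ).mapV x) (X.boundaryPath σ x) ((X.att σ).mapV x) := by
  have h := isPath_ofFn (G := X.toSGraph) (X.len σ)
    (fun k : ℕ => (X.att σ).mapV (x + k : ZMod (max (X.len σ) 1)))
    (fun j : Fin (X.len σ) => (X.att σ).mapE
      (⟨x + (j : ℕ), true, Nat.ne_zero_of_lt j.2⟩ : CircleEdge (X.len σ)))
    (fun i => (BottomUp.edge_isPath σ _ (Nat.ne_zero_of_lt i.2)).1)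
    (fun i => (BottomUp.edge_isPath σ _ (Nat.ne_zero_of_lt i.2)).2.trans
      (by push_cast; rw [add_assoc]))
  simp only [BottomUp.cast_len, Nat.cast_zero, add_zero] at h
  exact h

namespace Hom.IsCovering

variable {f : Hom Y X}

theorem lifts_spur (hf : f.IsCovering) {a b : Y.V} {e : X.E} (h : X.src e = f.mapV a) :
    f.Lifts a [e, X.inv e] b ↔ a = b := by
  obtain ⟨e, rfl, rfl⟩ := hf.exists_edge h
  have k : f.Lifts (Y.src e) [f.mapE e, X.inv (f.mapE e)] (Y.src e) :=
    ⟨[e, Y.inv e], ⟨rfl, rfl, congrArg Y.src (Y.inv_inv e)⟩, by simp [f.inv_map]⟩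
  exact ⟨fun h => hf.lifts_unique k h, fun h => h ▸ k⟩

/-- Surjectivity on corners gives a face of `Y` with a corner at `a` over `(σ, x)`. Its boundary
path read from that corner is a closed lift, and by uniqueness it is the only one. -/
theorem lifts_boundaryPath (hf : f.IsCovering) {a b : Y.V} {σ : X.F}
    {x : ZMod (max (X.len σ) 1)} (h : (X.att σ).mapV x = f.mapV a) :
    f.Lifts a (X.boundaryPath σ x) b ↔ a = b := by
  obtain ⟨⟨σ', x'⟩, rfl, hc⟩ := hf.exists_corner (c := ⟨σ, x⟩) h
  obtain rfl : f.mapF σ' = σ := congrArg Sigma.fst hc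
  obtain rfl : (f.eps σ').mapV x' = x := eq_of_heq (Sigma.mk.inj hc).2
  have k : f.Lifts (Corner.at ⟨σ', x'⟩) (X.boundaryPath (f.mapF σ') (circV (f.eps σ') x'))
    (Corner.at ⟨σ', x'⟩) := ⟨_, isPath_boundaryPath σ' x', f.map_boundaryPath σ' x'⟩
  exact ⟨fun h => hf.lifts_unique k h, fun h => h ▸ k⟩

theorem lifts_homotopic (hf : f.IsCovering) {x z : X.V} {p q : GPath X.toSGraph x z}
    (h : Homotopic p q) {a b : Y.V} (ha : f.mapV a = x) :
    f.Lifts a p.edges b ↔ f.Lifts a q.edges b := by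
  induction h with
  | refl p => rfl
  | symm p q _ ih => exact ih.symm
  | trans p q r _ _ ih₁ ih₂ => exact ih₁.trans ih₂
  | rel p q h =>
    obtain ⟨l₁, m, l₂, hp, hq, hm⟩ := h
    obtain ⟨w, hw, -⟩ := isPath_split (hq ▸ q.isPath)
    obtain ⟨u, hu, hum⟩ := isPath_split hw
    -- The inserted piece `m` lifts only to closed paths, so inserting it does not move the end of a
    -- lift.
    have key : ∀ c d, f.Lifts a l₁ c → (f.Lifts c m d ↔ c = d) := by
      intro c d hc
      have hcu : f.mapV c = u := isPath_end_unique (ha ▸ hc.isPath) hu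
      rcases hm with ⟨e, rfl⟩ | ⟨σ, x, rfl⟩
      · exact hf.lifts_spur (hum.1.trans hcu.symm)
      -- For a face of length `0` the inserted path is empty, and incidence does not say that `x` is
      -- attached at `u`. Otherwise the first edge of the boundary path identifies the vertex under
      -- `x` with `u`.
      · by_cases h0 : X.len σ = 0
        · have : X.boundaryPath σ x = [] :=
            List.length_eq_zero_iff.1 (by simpa [boundaryPath] using h0)
          rw [this]
          exact lifts_nil
        · refine hf.lifts_boundaryPath (Eq.trans ?_ hcu.symm)
          have hx := isPath_boundaryPath σ x
          have hne : X.boundaryPath σ x ≠ [] := fun h =>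
            h0 (by simpa [boundaryPath] using congrArg List.length h)
          obtain ⟨e, l, hl⟩ := List.exists_cons_of_ne_nil hne
          rw [hl] at hx hum
          exact hx.1.symm.trans hum.1
    rw [hp, hq, lifts_append, lifts_append]
    constructor
    · rintro ⟨c, h₁, h₂⟩
      exact ⟨c, lifts_append.2 ⟨c, h₁, (key c c h₁).2 rfl⟩, h₂⟩
    · rintro ⟨d, h, h₂⟩
      obtain ⟨c, h₁, h₃⟩ := lifts_append.1 h
      obtain rfl := (key c d h₁).1 h₃
      exact ⟨c, h₁, h₂⟩

/-- A closed path represents an element of `f_* π₁(Y, y)` if and only if its lift to `y` is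
closed. -/
theorem mk_mem_range (hf : f.IsCovering) {y : Y.V} {v : X.V} (h : f.mapV y = v)
    (p : GPath X.toSGraph v v) :
    Pi1.mk p ∈ (f.pi1Map h).range ↔ f.Lifts y p.edges y := by
  constructor
  · rintro ⟨⟨q⟩, hq⟩
    have hq' : Homotopic (f.mapPath h h q) p := Pi1.mk_eq.1 hq
    exact (hf.lifts_homotopic hq' h).1 ⟨q.edges, q.isPath, rfl⟩
  · rintro ⟨L, hL, k⟩
    exact ⟨Pi1.mk ⟨L, hL⟩, congrArg Pi1.mk (GPath.ext k)⟩

end Hom.IsCovering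

/-! ## Inverting corners, and rigidity of maps of 1-spheres -/

/-- The corner of the inverse face at the same place. -/
def Corner.flip (c : X.Corner) : X.Corner :=
  ⟨X.finv c.1, (circleFlip (X.len_finv c.1).symm).mapV c.2⟩

theorem circleFlip_comp {m n : ℕ} (h : m = n) :
    (circleFlip h).comp (circleFlip h.symm) = GraphHom.id (circle n) := by
  subst h
  refine GraphHom.ext (funext fun x => neg_neg (G := ZMod (max m 1)) x) (funext fun c => ?_)
  refine CircleEdge.ext ?_ (Bool.not_not _)
  show -(-CircleEdge.idx c - 1) - 1 = CircleEdge.idx c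
  ring

theorem Corner.at_flip (c : X.Corner) : c.flip.at = c.at := by
  have h := congrArg (fun φ => GraphHom.mapV φ c.flip.2) (X.att_finv c.1)
  exact h.trans (congrArg (fun φ => (X.att c.1).mapV (GraphHom.mapV φ c.2))
    (circleFlip_comp (X.len_finv c.1)))

/-- The face equation is a hypothesis on a variable `σ'`, so it can be substituted away. For
`f.mapF_finv`, whose two sides are not variables, this is what makes the dependent second components
comparable. -/
theorem corner_ext_of_flip {σ σ' : X.F} (h : σ' = X.finv σ) {x : (circle (X.len σ)).V}
    {x' : (circle (X.len σ')).V} (l : X.len σ' = X.len σ) (k : (circleFlip l).mapV x' = x) :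
    (⟨σ', x'⟩ : X.Corner) = Corner.flip ⟨σ, x⟩ := by
  subst h
  subst k
  exact congrArg (Sigma.mk (X.finv σ)) (congrArg (fun φ => GraphHom.mapV φ x')
    (circleFlip_comp (X.len_finv σ).symm)).symm

theorem Hom.cornerMap_flip (f : Hom Y X) (c : Y.Corner) :
    f.cornerMap c.flip = (f.cornerMap c).flip := by
  refine corner_ext_of_flip (f.mapF_finv c.1)
    ((congrArg X.len (f.mapF_finv c.1)).trans (X.len_finv _)) ?_
  have h := congrArg (fun φ => GraphHom.mapV φ c.flip.2) (f.eps_finv c.1)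
  exact h.trans (congrArg (fun φ => (f.eps c.1).mapV (GraphHom.mapV φ c.2))
    (circleFlip_comp (Y.len_finv c.1)))

theorem Corner.flip_zero (σ : X.F) :
    Corner.flip (⟨σ, (0 : ZMod (max (X.len σ) 1))⟩ : X.Corner) =
      ⟨X.finv σ, (0 : ZMod (max (X.len (X.finv σ)) 1))⟩ :=
  congrArg (Sigma.mk (X.finv σ)) (BottomUp.circleFlip_zero _)

/-- A forward edge goes to the forward edge starting at the image of its start, so vertices
determine edges. Preservation of orientation is essential: on the sphere of length `1` the vertex
map does not see a reversal of the loop. -/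
theorem _root_.CombTop.IsCircleIso.ext {m n : ℕ} {ε ε' : GraphHom (circle m) (circle n)}
    (h : IsCircleIso ε) (h' : IsCircleIso ε') (k : ε.mapV = ε'.mapV) : ε = ε' := by
  refine GraphHom.ext k (funext ?_)
  have ht : ∀ (x : ZMod (max m 1)) (hm : m ≠ 0), ε.mapE (⟨x, true, hm⟩ : CircleEdge m) =
      ε'.mapE (⟨x, true, hm⟩ : CircleEdge m) := by
    intro x hm
    have hn : n ≠ 0 := h.len_eq ▸ hm
    rw [h.mapE_idx x hm hn, h'.mapE_idx x hm hn, circV, circV, k]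
  rintro ⟨x, b, hm⟩
  cases b
  · exact (ε.inv_map (⟨x, true, hm⟩ : CircleEdge m)).trans ((congrArg (circle n).inv (ht x hm)).trans
      (ε'.inv_map (⟨x, true, hm⟩ : CircleEdge m)).symm)
  · exact ht x hm

/-- Two maps from a 1-sphere to a covering agree if they have the same projection and agree at
the vertex `0`. -/
theorem Hom.IsCovering.circleHom_ext {f : Hom Y X} (hf : f.IsCovering) {n : ℕ}
    {φ ψ : GraphHom (circle n) Y.toSGraph} (h : f.toGraphHom.comp φ = f.toGraphHom.comp ψ)
    (h0 : φ.mapV (0 : ZMod (max n 1)) = ψ.mapV (0 : ZMod (max n 1))) : φ = ψ := by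
  have hE : ∀ c, φ.mapV ((circle n).src c) = ψ.mapV ((circle n).src c) → φ.mapE c = ψ.mapE c := by
    intro c hc
    rw [← φ.src_map, ← ψ.src_map] at hc
    exact hf.edge_ext hc (congrArg (fun θ => GraphHom.mapE θ c) h)
  have : NeZero (max n 1) := ⟨by omega⟩
  have hk : ∀ k : ℕ, φ.mapV (k : ZMod (max n 1)) = ψ.mapV (k : ZMod (max n 1)) := by
    intro k
    -- The sphere of length `0` has one vertex and no edge to walk along. In positive length the
    -- vertex `k` is reached from `0` by `k` forward edges.
    by_cases hn : n = 0
    · subst hn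
      have : (k : ZMod (max 0 1)) = 0 := Subsingleton.elim (α := ZMod 1) _ _
      rw [this]
      exact h0
    · induction k with
      | zero => simpa using h0
      | succ k ih =>
        have e := hE (⟨(k : ZMod (max n 1)), true, hn⟩ : CircleEdge n) ih
        have h1 := φ.tgt_map (⟨(k : ZMod (max n 1)), true, hn⟩ : CircleEdge n)
        have h2 := ψ.tgt_map (⟨(k : ZMod (max n 1)), true, hn⟩ : CircleEdge n)
        rw [e] at h1
        have h3 := h1.symm.trans h2
        rw [Nat.cast_succ]
        exact h3
  have hV : ∀ x : ZMod (max n 1), φ.mapV x = ψ.mapV x := fun x => by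
    have := hk x.val
    rwa [ZMod.natCast_zmod_val] at this
  exact GraphHom.ext (funext hV) (funext fun c => hE c (hV _))

/-- Lifts of a map to a covering are determined by the image of one vertex. -/
theorem Hom.IsCovering.lift_unique {f : Hom Y X} (hf : f.IsCovering) (hZ : Z.Connected)
    {g k : Hom Z Y} (h : f.comp g = f.comp k) {z : Z.V} (hz : g.mapV z = k.mapV z) : g = k := by
  have hV : ∀ a, g.mapV a = k.mapV a := fun a => by
    obtain ⟨l, hl⟩ := (f.comp g).exists_lifts_of_connected hZ z a
    have hk := hl
    rw [h] at hk
    have h₁ := hl.comp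
    rw [hz] at h₁
    exact hf.lifts_unique h₁ hk.comp
  have hE : ∀ e, g.mapE e = k.mapE e := fun e =>
    hf.edge_ext (by rw [g.src_map, k.src_map, hV]) (congrArg (fun φ : Hom Z X => φ.mapE e) h)
  -- Equality on corners contains both equality on faces and equality of the `ε` on vertices of the
  -- spheres, hence of the `ε` themselves.
  have hC : ∀ c, g.cornerMap c = k.cornerMap c := fun c =>
    hf.corner_ext (by rw [g.cornerMap_at, k.cornerMap_at, hV])
      (congrArg (fun φ : Hom Z X => φ.cornerMap c) h)
  have hF : g.mapF = k.mapF := funext fun σ =>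
    congrArg Sigma.fst (hC ⟨σ, (0 : ZMod (max (Z.len σ) 1))⟩)
  refine Hom.ext_heq (GraphHom.ext (funext hV) (funext hE)) hF fun σ => ?_
  have key : ∀ (τ τ' : Y.F) (ε : GraphHom (circle (Z.len σ)) (circle (Y.len τ)))
      (ε' : GraphHom (circle (Z.len σ)) (circle (Y.len τ'))), IsCircleIso ε → IsCircleIso ε' →
      τ = τ' → (∀ x, (⟨τ, ε.mapV x⟩ : Y.Corner) = ⟨τ', ε'.mapV x⟩) → HEq ε ε' := by
    intro τ τ' ε ε' h h' e hx
    subst e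
    exact heq_of_eq (h.ext h' (funext fun x => eq_of_heq (Sigma.mk.inj (hx x)).2))
  exact key _ _ _ _ (g.eps_iso σ) (k.eps_iso σ) (congrFun hF σ) fun x => hC ⟨σ, x⟩

/-! ## The lifting criterion -/

namespace Hom

/-- The face part of a lift: over a corner of `Z` there is a face of `Y` whose boundary sphere is
compatibly identified with that of the given face. -/
theorem exists_eps {f : Hom Y X} {k : Hom Z X} {σ : Z.F} {x : (circle (Z.len σ)).V}
    {σ' : Y.F} {x' : (circle (Y.len σ')).V}
    (h : f.cornerMap ⟨σ', x'⟩ = k.cornerMap ⟨σ, x⟩) :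
    ∃ ε : GraphHom (circle (Z.len σ)) (circle (Y.len σ')), IsCircleIso ε ∧ ε.mapV x = x' ∧
      HEq ((f.eps σ').comp ε) (k.eps σ) := by
  have key : ∀ (τ : X.F) (φ : GraphHom (circle (Z.len σ)) (circle (X.len τ))), IsCircleIso φ →
      (⟨f.mapF σ', (f.eps σ').mapV x'⟩ : X.Corner) = ⟨τ, φ.mapV x⟩ →
      ∃ ε : GraphHom (circle (Z.len σ)) (circle (Y.len σ')), IsCircleIso ε ∧ ε.mapV x = x' ∧
        HEq ((f.eps σ').comp ε) φ := by
    intro τ φ hφ hc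
    obtain rfl : f.mapF σ' = τ := congrArg Sigma.fst hc
    have hx : (f.eps σ').mapV x' = φ.mapV x := eq_of_heq (Sigma.mk.inj hc).2
    have hi := f.eps_iso σ'
    have e₁ := (f.eps σ').comp_inverse hi.bijV hi.bijE
    -- The required identity `ε(f, σ') ε = φ` leaves no other choice.
    refine ⟨((f.eps σ').inverse hi.bijV hi.bijE).comp φ, ⟨?_, ?_, fun c => ?_⟩, ?_, ?_⟩
    · exact (Equiv.ofBijective _ hi.bijV).symm.bijective.comp hφ.bijV
    · exact (Equiv.ofBijective _ hi.bijE).symm.bijective.comp hφ.bijE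
    · refine (hi.fwd_map _).symm.trans (Eq.trans ?_ (hφ.fwd_map c))
      exact congrArg (fun θ => CircleEdge.fwd (GraphHom.mapE θ (φ.mapE c))) e₁
    · show (Equiv.ofBijective _ hi.bijV).symm (φ.mapV x) = x'
      rw [← hx, Equiv.ofBijective_symm_apply_apply]
    · exact heq_of_eq (congrArg (fun θ => GraphHom.comp θ φ) e₁)
  exact key _ _ (k.eps_iso σ) h

/-- This is the compatibility of a lift with attaching maps after projection to `X`; `circleHom_ext`
then gives it in `Y`. The faces `f σ'` and `k σ` are only propositionally equal, whence `HEq` and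
the generalisation to a variable `τ`. -/
theorem att_comp_of_heq {f : Hom Y X} {k : Hom Z X} {σ : Z.F} {σ' : Y.F}
    {ε : GraphHom (circle (Z.len σ)) (circle (Y.len σ'))} (hF : f.mapF σ' = k.mapF σ)
    (hε : HEq ((f.eps σ').comp ε) (k.eps σ)) :
    f.toGraphHom.comp ((Y.att σ').comp ε) = k.toGraphHom.comp (Z.att σ) := by
  have key : ∀ (τ : X.F) (φ : GraphHom (circle (Z.len σ)) (circle (X.len τ))), f.mapF σ' = τ →
      HEq ((f.eps σ').comp ε) φ →
      f.toGraphHom.comp ((Y.att σ').comp ε) = (X.att τ).comp φ := by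
    intro τ φ e h
    subst e
    rw [← eq_of_heq h]
    exact congrArg (fun θ => GraphHom.comp θ ε) (f.att_comm σ')
  exact (key _ _ hF hε).trans (k.att_comm σ).symm

/-- Both sides become equal after composition with the invertible `ε(f, σ')`, because `f` and `k`
respect inversion of faces. -/
theorem flip_comp_of_heq {f : Hom Y X} {k : Hom Z X} {σ : Z.F} {σ' σ'' : Y.F}
    {ε : GraphHom (circle (Z.len σ)) (circle (Y.len σ'))}
    {ε' : GraphHom (circle (Z.len (Z.finv σ))) (circle (Y.len σ''))} (hσ : σ'' = Y.finv σ')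
    (hF : f.mapF σ' = k.mapF σ)
    (hε : HEq ((f.eps σ').comp ε) (k.eps σ))
    (hε' : HEq ((f.eps σ'').comp ε') (k.eps (Z.finv σ))) (l : Y.len σ'' = Y.len σ') :
    (circleFlip l).comp ε' = ε.comp (circleFlip (Z.len_finv σ)) := by
  subst hσ
  have key : ∀ (τ τ' : X.F) (φ : GraphHom (circle (Z.len σ)) (circle (X.len τ)))
      (φ' : GraphHom (circle (Z.len (Z.finv σ))) (circle (X.len τ'))) (l' : X.len τ' = X.len τ),
      f.mapF σ' = τ → f.mapF (Y.finv σ') = τ' → HEq ((f.eps σ').comp ε) φ →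
      HEq ((f.eps (Y.finv σ')).comp ε') φ' →
      (circleFlip l').comp φ' = φ.comp (circleFlip (Z.len_finv σ)) →
      (circleFlip l).comp ε' = ε.comp (circleFlip (Z.len_finv σ)) := by
    intro τ τ' φ φ' l' e e' h h' hφ
    subst e
    subst e'
    obtain rfl := eq_of_heq h
    obtain rfl := eq_of_heq h'
    have hi := f.eps_iso σ'
    have e₂ := (f.eps σ').inverse_comp hi.bijV hi.bijE
    have e₃ := f.eps_finv σ'
    calc (circleFlip l).comp ε'
        = (((f.eps σ').inverse hi.bijV hi.bijE).comp (f.eps σ')).comp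
            ((circleFlip l).comp ε') := by rw [e₂]; rfl
      _ = ((f.eps σ').inverse hi.bijV hi.bijE).comp
            (((f.eps σ').comp (circleFlip l)).comp ε') := rfl
      _ = ((f.eps σ').inverse hi.bijV hi.bijE).comp
            ((circleFlip l').comp ((f.eps (Y.finv σ')).comp ε')) := by rw [← e₃]; rfl
      _ = (((f.eps σ').inverse hi.bijV hi.bijE).comp (f.eps σ')).comp
            (ε.comp (circleFlip (Z.len_finv σ))) := by rw [hφ]; rfl
      _ = _ := by rw [e₂]; rfl
  refine key _ _ _ _ ((congrArg X.len (k.mapF_finv σ)).trans (X.len_finv _)) hF ?_ hε hε'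
    (k.eps_finv σ)
  rw [f.mapF_finv, k.mapF_finv, hF]

/-- The lifting criterion: a map `k` from a connected complex lifts through a covering `f` once
every closed path of `X` that lifts to a closed path at `z` lifts to a closed path at `y`. -/
theorem IsCovering.exists_lift {f : Hom Y X} (hf : f.IsCovering) (hZ : Z.Connected) {k : Hom Z X}
    {z : Z.V} {y : Y.V} (hzy : k.mapV z = f.mapV y)
    (hl : ∀ l, k.Lifts z l z → f.Lifts y l y) :
    ∃ g : Hom Z Y, g.mapV z = y ∧ f.comp g = k := by
  have hV : ∀ a, ∃ b, ∀ l, k.Lifts z l a → f.Lifts y l b := by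
    intro a
    obtain ⟨l, h⟩ := k.exists_lifts_of_connected hZ z a
    obtain ⟨b, hb, -⟩ := hf.exists_lifts (hzy ▸ h.isPath)
    refine ⟨b, fun m hm => ?_⟩
    -- Independence of the path: `m l⁻¹` has a closed lift at `z`, hence one at `y`. At its midpoint
    -- `c` the lift of `m` ends, and so does the lift of `l` read backwards, so `c` is `b`.
    obtain ⟨c, h₁, h₂⟩ := lifts_append.1 (hl _ (lifts_append.2 ⟨a, hm, h.rev⟩))
    have h₃ := h₂.rev
    rw [revEdges_revEdges] at h₃
    obtain rfl := hf.lifts_unique hb h₃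
    exact h₁
  choose G hG using hV
  have hGk : ∀ a, f.mapV (G a) = k.mapV a := fun a => by
    obtain ⟨l, h⟩ := k.exists_lifts_of_connected hZ z a
    exact isPath_end_unique (hG a l h).isPath (hzy ▸ h.isPath)
  have hE : ∀ e : Z.E, ∃ e', Y.src e' = G (Z.src e) ∧ f.mapE e' = k.mapE e := fun e =>
    hf.exists_edge (by rw [hGk, k.src_map])
  choose GE hGs hGE using hE
  -- A path to the start of `e`, extended by `e`, is a path to its end; uniqueness compares the two
  -- resulting lifts.
  have hGt : ∀ e, Y.tgt (GE e) = G (Z.tgt e) := by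
    intro e
    obtain ⟨l, h⟩ := k.exists_lifts_of_connected hZ z (Z.src e)
    have h₁ := hG _ _ (lifts_append.2 ⟨_, h, k.lifts_edge e⟩)
    have h₂ := f.lifts_edge (GE e)
    rw [hGs, hGE] at h₂
    exact hf.lifts_unique (lifts_append.2 ⟨_, hG _ _ h, h₂⟩) h₁
  let g : GraphHom Z.toSGraph Y.toSGraph :=
    { mapV := G
      mapE := GE
      src_map := hGs
      inv_map := fun e => hf.edge_ext ((hGs _).trans (hGt e).symm)
        (by rw [hGE, k.inv_map, f.inv_map, hGE]) }
  have hfg : f.toGraphHom.comp g = k.toGraphHom := GraphHom.ext (funext hGk) (funext hGE)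
  have hC : ∀ c : Z.Corner, ∃ c' : Y.Corner, c'.at = G c.at ∧ f.cornerMap c' = k.cornerMap c :=
    fun c => hf.exists_corner (by rw [hGk, k.cornerMap_at])
  choose C hCat hCk using hC
  -- The lifted corner is unique, so the choice `C` automatically commutes with inversion.
  have hCflip : ∀ c, C c.flip = (C c).flip := fun c =>
    hf.corner_ext (by rw [hCat, Corner.at_flip, Corner.at_flip, hCat])
      (by rw [hCk, cornerMap_flip, cornerMap_flip, hCk])
  -- The image of a face is read off at its corner `0`, which the reflection `ι` fixes; hence
  -- inverse faces get inverse images.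
  let z₀ : ∀ σ : Z.F, Z.Corner := fun σ => ⟨σ, (0 : ZMod (max (Z.len σ) 1))⟩
  have hF : ∀ σ, f.mapF (C (z₀ σ)).1 = k.mapF σ := fun σ => congrArg Sigma.fst (hCk (z₀ σ))
  have hfin : ∀ σ, (C (z₀ (Z.finv σ))).1 = Y.finv (C (z₀ σ)).1 := fun σ => by
    have h := hCflip (z₀ σ)
    rw [Corner.flip_zero] at h
    exact congrArg Sigma.fst h
  have hε : ∀ σ, ∃ ε : GraphHom (circle (Z.len σ)) (circle (Y.len (C (z₀ σ)).1)),
      IsCircleIso ε ∧ ε.mapV (0 : ZMod (max (Z.len σ) 1)) = (C (z₀ σ)).2 ∧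
        HEq ((f.eps (C (z₀ σ)).1).comp ε) (k.eps σ) := fun σ => exists_eps (hCk (z₀ σ))
  choose ε hεi hε0 hεk using hε
  let g' : Hom Z Y :=
    { toGraphHom := g
      mapF := fun σ => (C (z₀ σ)).1
      eps := ε
      eps_iso := hεi
      att_comm := fun σ => by
        refine hf.circleHom_ext ?_ ?_
        · exact (congrArg (fun θ => GraphHom.comp θ (Z.att σ)) hfg).trans
            (att_comp_of_heq (hF σ) (hεk σ)).symm
        · exact (hCat (z₀ σ)).symm.trans
            (congrArg (Y.att (C (z₀ σ)).1).mapV (hε0 σ).symm)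
      mapF_finv := hfin
      eps_finv := fun σ => flip_comp_of_heq (hfin σ) (hF σ) (hεk σ) (hεk (Z.finv σ)) _ }
  refine ⟨g', ?_, Hom.ext_heq hfg (funext hF) hεk⟩
  exact (lifts_nil.1 (hG z [] (lifts_nil.2 rfl))).symm

/-- The local maps of `f g` are the composites of those of `f` and `g`, and the bijections belonging
to `f` cancel. -/
theorem IsCovering.of_comp {f : Hom Y X} (hf : f.IsCovering) {g : Hom Z Y}
    (h : (f.comp g).IsCovering) : g.IsCovering where
  edges := fun z => ((hf.edges (g.mapV z)).of_comp_iff' (g.localE z)).1 (h.edges z)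
  faces := fun z => ((hf.faces (g.mapV z)).of_comp_iff' (g.localF z)).1 (h.faces z)

end Hom

/-! ## The correspondence between pointed coverings and subgroups -/

namespace PointedCover

variable {v : X.V}

theorem mk_mem_subgroup (c : PointedCover X v) (p : GPath X.toSGraph v v) :
    Pi1.mk p ∈ c.subgroup ↔ c.proj.Lifts c.base p.edges c.base :=
  c.isCovering.mk_mem_range c.proj_base p

/-- A covering `d → c` carries closed lifts at the base point to closed lifts. Conversely, the
inclusion is exactly the hypothesis of the lifting criterion for the projection of `d`. -/
theorem le_iff_subgroup_le {c d : PointedCover X v} : c.Le d ↔ d.subgroup ≤ c.subgroup := by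
  constructor
  · rintro ⟨g, -, hb, hp⟩ ⟨p⟩ h
    refine (c.mk_mem_subgroup p).2 ?_
    have h₁ := (d.mk_mem_subgroup p).1 h
    rw [← hp] at h₁
    have h₂ := h₁.comp
    rwa [hb] at h₂
  · intro h
    obtain ⟨g, hg, hp⟩ := c.isCovering.exists_lift d.connected (k := d.proj) (z := d.base)
      (y := c.base) (d.proj_base.trans c.proj_base.symm) (fun l hl => by
        have hv := hl.isPath
        rw [d.proj_base] at hv
        exact (c.mk_mem_subgroup ⟨l, hv⟩).1 (h ((d.mk_mem_subgroup ⟨l, hv⟩).2 hl)))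
    exact ⟨g, c.isCovering.of_comp (hp ▸ d.isCovering), hg, hp⟩

end PointedCover

/-! ### The subgroup belonging to the bottom-up cover -/

namespace BottomUp

variable {v : X.V} {H : Subgroup (Pi1 X v)}

/-- This refines `BottomUp.exists_lift` by recording that the path found lies over `l`, which
identifies `walk` with path lifting in `X↑H`. -/
theorem lifts_walk (l : List X.E) (a : Vertex H) (c : X.V)
    (h : IsPath X.toSGraph (endV a) l c) : (proj H).Lifts a l (walk l a) := by
  induction l generalizing a with
  | nil => exact Hom.lifts_nil.2 (walk_nil a).symm
  | cons e l ih =>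
    have h1 : IsPath X.toSGraph (endV a) [e] (X.tgt e) := ⟨h.1, rfl⟩
    have h2 := h.2
    rw [← endV_walk h1] at h2
    have h3 := walk_append h1 h.2
    rw [List.singleton_append] at h3
    rw [h3]
    exact Hom.lifts_append (l := [e]).2
      ⟨_, (proj H).lifts_edge (⟨(a, e), h.1.symm⟩ : (graph H).E), ih _ h2⟩

end BottomUp

theorem bottomUp_subgroup (X : TwoComplex.{u}) (v : X.V) (H : Subgroup (Pi1 X v)) :
    (bottomUp X v H).subgroup = H := by
  ext ⟨p⟩
  refine ((bottomUp X v H).mk_mem_subgroup p).trans ?_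
  have hw : (BottomUp.proj H).Lifts (BottomUp.baseV H) p.edges
      (BottomUp.walk p.edges (BottomUp.baseV H)) := BottomUp.lifts_walk _ _ v p.isPath
  have hm : BottomUp.walk p.edges (BottomUp.baseV H) =
      BottomUp.Vertex.mk H ⟨v, p⟩ := BottomUp.walk_mk (GPath.nil v) p.isPath
  rw [hm] at hw
  -- The lift of `p` at the base point ends at `u_p`, so it is closed if and only if `p` is
  -- equivalent to the trivial path.
  have hr : BottomUp.Vertex.mk H ⟨v, p⟩ = BottomUp.baseV H ↔ Pi1.mk p ∈ H := by
    have e : p.trans (GPath.nil v).symm = p := GPath.ext (List.append_nil _)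
    have h := BottomUp.rel_iff H p (GPath.nil v)
    rw [e] at h
    rw [← h]
    exact ⟨fun h => Quotient.exact h, fun h => Quotient.sound (s := BottomUp.setoid H) h⟩
  refine Iff.trans ⟨fun h => ?_, fun h => ?_⟩ hr
  · exact (BottomUp.proj_isCovering H).lifts_unique hw h
  · rw [h] at hw
    exact hw

/-- The anti-isomorphism from the equivalence classes of pointed coverings to the subgroups of the
fundamental group. -/
noncomputable def galoisEquiv (X : TwoComplex.{u}) (v : X.V) :
    CoverClass X v ≃o (Subgroup (Pi1 X v))ᵒᵈ where
  toFun := Quotient.lift (fun c => OrderDual.toDual c.subgroup) fun _ _ h =>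
    congrArg OrderDual.toDual (le_antisymm
      (PointedCover.le_iff_subgroup_le.1 (PointedCover.Equivalent.le h))
      (PointedCover.le_iff_subgroup_le.1
        (PointedCover.Equivalent.le (PointedCover.Equivalent.symm h))))
  invFun := fun H => (bottomUp X v (OrderDual.ofDual H)).cls
  left_inv := by
    rintro ⟨c⟩
    have h := bottomUp_subgroup X v c.subgroup
    -- Coverings with equal subgroups cover each other, and pointed coverings in both directions are
    -- mutually inverse.
    exact PointedCover.cls_eq.2 (PointedCover.Le.antisymm
      (PointedCover.le_iff_subgroup_le.2 h.ge) (PointedCover.le_iff_subgroup_le.2 h.le))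
  right_inv := fun H => congrArg OrderDual.toDual (bottomUp_subgroup X v (OrderDual.ofDual H))
  map_rel_iff' := by
    rintro ⟨c⟩ ⟨d⟩
    exact PointedCover.le_iff_subgroup_le.symm

/-! ## Galois coverings and normal subgroups -/

namespace PointedCover

variable {v : X.V}

/-- Transitivity on the fibre of a single vertex `x` suffices: a path `d` from `v` to `x` transports
it to the fibre of `v`. -/
theorem normal_of_isGaloisVia (hX : X.Connected) (c : PointedCover X v) {x : X.V}
    (h : c.proj.IsGaloisVia x) : c.subgroup.Normal := by
  refine ⟨?_⟩
  rintro ⟨r⟩ hr ⟨p⟩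
  replace hr := (c.mk_mem_subgroup r).1 hr
  refine (c.mk_mem_subgroup ((p.trans r).trans p.symm)).2 ?_
  obtain ⟨d⟩ := hX v x
  have hb : ∀ {l : List X.E} {w}, IsPath X.toSGraph v l w →
      ∃ b, c.proj.Lifts c.base l b ∧ c.proj.mapV b = w := fun k =>
    c.isCovering.exists_lifts (c.proj_base.symm ▸ k)
  obtain ⟨b, hpb, hbv⟩ := hb p.isPath
  obtain ⟨y₁, h₁, hx₁⟩ := hb d.isPath
  obtain ⟨y₂, h₂, hx₂⟩ := c.isCovering.exists_lifts (a := b) (by rw [hbv]; exact d.isPath)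
  -- The vertices `y₁` and `y₂` are the ends of the lifts of `d` at the base point and at the end
  -- `b` of the lift of `p`. Going back along `d` shows that `a` moves the base point to `b`.
  obtain ⟨a, ⟨⟨-, ha⟩, hay⟩, -⟩ := h y₁ y₂ hx₁ hx₂
  have hab : a.mapV c.base = b := by
    have k := h₁.rev
    rw [← ha] at k
    have k := k.comp
    rw [hay] at k
    exact c.isCovering.lifts_unique k h₂.rev
  have hrb : c.proj.Lifts b r.edges b := by
    rw [← ha] at hr
    have k := hr.comp
    rwa [hab] at k
  -- The lift of `p r p⁻¹` goes out to `b`, traverses the image under `a` of the closed lift of `r`,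
  -- and returns.
  exact Hom.lifts_append.2 ⟨b, Hom.lifts_append.2 ⟨b, hpb, hrb⟩, hpb.rev⟩

/-- With `p₁`, `p₂` the projections of paths from the base point to `y₁`, `y₂`, the class of `p₂ l
p₂⁻¹` is the conjugate of that of `p₁ l p₁⁻¹` by `p₂ p₁⁻¹`, so normality passes closedness of the
lift from one to the other. -/
theorem lifts_of_normal (c : PointedCover X v) (h : c.subgroup.Normal) {y₁ y₂ : c.cover.V}
    (hy : c.proj.mapV y₁ = c.proj.mapV y₂) {l : List X.E} (hl : c.proj.Lifts y₁ l y₁) :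
    c.proj.Lifts y₂ l y₂ := by
  obtain ⟨m₁, h₁⟩ := c.proj.exists_lifts_of_connected c.connected c.base y₁
  obtain ⟨m₂, h₂⟩ := c.proj.exists_lifts_of_connected c.connected c.base y₂
  have k₁ := h₁.isPath
  have k₂ := h₂.isPath
  have kl := hl.isPath
  rw [c.proj_base] at k₁ k₂
  rw [← hy] at k₂
  let p₁ : GPath X.toSGraph v _ := ⟨m₁, k₁⟩
  let p₂ : GPath X.toSGraph v _ := ⟨m₂, k₂⟩
  let q : GPath X.toSGraph _ _ := ⟨l, kl⟩
  have hm : Pi1.mk ((p₁.trans q).trans p₁.symm) ∈ c.subgroup := (c.mk_mem_subgroup _).2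
    (Hom.lifts_append.2 ⟨y₁, Hom.lifts_append.2 ⟨y₁, h₁, hl⟩, h₁.rev⟩)
  have hn := h.conj_mem _ hm (Pi1.mk (p₂.trans p₁.symm))
  have e : Pi1.mk (p₂.trans p₁.symm) * Pi1.mk ((p₁.trans q).trans p₁.symm) *
      (Pi1.mk (p₂.trans p₁.symm))⁻¹ = Pi1.mk ((p₂.trans q).trans p₂.symm) := by
    have e₁ : Pi1.mk (p₂.trans p₁.symm) * Pi1.mk ((p₁.trans q).trans p₁.symm) =
        Pi1.mk ((p₂.trans q).trans p₁.symm) := by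
      refine Pi1.mk_eq.2 ?_
      have := BottomUp.homotopic_cancel p₂ p₁ (q.trans p₁.symm)
      have e₂ : p₁.trans (q.trans p₁.symm) = (p₁.trans q).trans p₁.symm :=
        GPath.ext (List.append_assoc _ _ _).symm
      have e₃ : p₂.trans (q.trans p₁.symm) = (p₂.trans q).trans p₁.symm :=
        GPath.ext (List.append_assoc _ _ _).symm
      rwa [e₂, e₃] at this
    rw [e₁, Pi1.mk_inv]
    have e₂ : (p₂.trans p₁.symm).symm = p₁.trans p₂.symm :=
      GPath.ext (by simp [GPath.trans, GPath.symm, revEdges_append, revEdges_revEdges])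
    rw [e₂]
    exact Pi1.mk_eq.2 (BottomUp.homotopic_cancel (p₂.trans q) p₁ p₂.symm)
  rw [e] at hn
  obtain ⟨b, hb, hb'⟩ := Hom.lifts_append.1 ((c.mk_mem_subgroup _).1 hn)
  obtain ⟨b', hb₁, hb₂⟩ := Hom.lifts_append.1 hb
  have hb'' := hb'.rev
  change c.proj.Lifts c.base (revEdges _ (revEdges _ m₂)) b at hb''
  rw [revEdges_revEdges] at hb''
  -- In the closed lift of `p₂ l p₂⁻¹` the outer parts both join the base point to `y₂`, so the
  -- middle part is a closed lift of `l` at `y₂`.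
  obtain rfl := c.isCovering.lifts_unique h₂ hb₁
  obtain rfl := c.isCovering.lifts_unique h₂ hb''
  exact hb₂

theorem isGaloisVia_of_normal (c : PointedCover X v) (h : c.subgroup.Normal) (x : X.V) :
    c.proj.IsGaloisVia x := by
  intro y₁ y₂ hy₁ hy₂
  -- The same covering is pointed at `y₁` and at `y₂`, over the new base point `x`. An equivalence
  -- between the two is precisely a deck transformation sending `y₁` to `y₂`.
  let d₁ : PointedCover X x := ⟨c.cover, y₁, c.proj, c.connected, c.isCovering, hy₁⟩
  let d₂ : PointedCover X x := ⟨c.cover, y₂, c.proj, c.connected, c.isCovering, hy₂⟩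
  have hs : d₁.subgroup = d₂.subgroup := by
    ext ⟨p⟩
    refine (d₁.mk_mem_subgroup p).trans (Iff.trans ?_ (d₂.mk_mem_subgroup p).symm)
    exact ⟨c.lifts_of_normal h (hy₁.trans hy₂.symm), c.lifts_of_normal h (hy₂.trans hy₁.symm)⟩
  obtain ⟨a, ha, hb, hp⟩ : d₁.Equivalent d₂ :=
    Le.antisymm (le_iff_subgroup_le.2 hs.ge) (le_iff_subgroup_le.2 hs.le)
  refine ⟨a, ⟨⟨ha, hp⟩, hb⟩, ?_⟩
  rintro a' ⟨⟨-, hp'⟩, hb'⟩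
  exact c.isCovering.lift_unique c.connected (hp'.trans hp.symm) (hb'.trans hb.symm)

end PointedCover

end TwoComplex

end CombTop

/-- Galois correspondence: for a connected 2-complex `X` with a vertex `v`, the equivalence classes
of pointed connected coverings of `X_v` form a lattice, the map `f ↦ f_* π₁(Y, y)` is an
anti-isomorphism from it onto the lattice of subgroups of `π₁(X, v)` whose inverse sends `H` to the
class of `X↑H`, and Galois coverings correspond to normal subgroups. -/
theorem mainTheorem3 (X : CombTop.TwoComplex.{u}) (hX : X.Connected) (v : X.V) :
    (∀ a b : CombTop.TwoComplex.CoverClass X v,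
      (∃ j, IsLUB {a, b} j) ∧ ∃ m, IsGLB {a, b} m) ∧
    ∃ Φ : CombTop.TwoComplex.CoverClass X v ≃o (Subgroup (CombTop.TwoComplex.Pi1 X v))ᵒᵈ,
      (∀ c : CombTop.TwoComplex.PointedCover X v, Φ c.cls = OrderDual.toDual c.subgroup) ∧
      (∀ H : Subgroup (CombTop.TwoComplex.Pi1 X v),
        Φ.symm (OrderDual.toDual H) = (CombTop.TwoComplex.bottomUp X v H).cls) ∧
      (∀ (c : CombTop.TwoComplex.PointedCover X v) (x : X.V),
        c.proj.IsGaloisVia x ↔ c.subgroup.Normal) := by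
  refine ⟨fun a b => ?_, CombTop.TwoComplex.galoisEquiv X v, fun c => rfl, fun H => rfl,
    fun c x => ⟨c.normal_of_isGaloisVia hX, fun h => c.isGaloisVia_of_normal h x⟩⟩
  let Φ := CombTop.TwoComplex.galoisEquiv X v
  -- The lattice structure is transported from the subgroups. As `Φ` takes values in the order dual,
  -- the join of two classes belongs to the intersection of their subgroups and the meet to the
  -- subgroup they generate.
  refine ⟨⟨Φ.symm (Φ a ⊔ Φ b), ?_⟩, ⟨Φ.symm (Φ a ⊓ Φ b), ?_⟩⟩
  · have h : IsLUB (Φ.symm '' {Φ a, Φ b}) (Φ.symm (Φ a ⊔ Φ b)) := Φ.symm.isLUB_image'.2 isLUB_pair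
    simpa [Set.image_pair] using h
  · have h : IsGLB (Φ.symm '' {Φ a, Φ b}) (Φ.symm (Φ a ⊓ Φ b)) := Φ.symm.isGLB_image'.2 isGLB_pair
    simpa [Set.image_pair] using h
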